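/- Let $\{z_t\}_{t\ge 1}$ be a white noise: square integrable, mean zero, pairwise uncorrelated, $\mathbb E z_t^2=\sigma^2>0$. Fix $\rho\in(-1,1)\setminus\{0\}$, $m\ge 0$, magnitudes $\varepsilon_1,\dots,\varepsilon_m\in\mathbb R$ with $|\rho+\varepsilon_j|>|\rho|$ for all $j$, and lengths $h_1,\dots,h_m\in\mathbb N$, $h_j\ge 1$. For each $n$ let $k_1(n),\dots,k_m(n)$ be break points such that, for all large $n$, $k_j(n)+h_j-1\le n$ for all $j$, and put $$\Delta_j(n)=k_j(n)-\bigl(k_{j-1}(n)+h_{j-1}-1\bigr)\quad(1\le j\le m),\qquad k_0+h_0-1:=0 .$$ Assume $\Delta(n)=\min_{1\le j\le m}\Delta_j(n)\to\infty$ as $n\to\infty$ (no condition if $m=0$). Let $B_n=[\operatorname{var}(y_1,\dots,y_n)]^{-1}$ be the precision matrix of the structural change model $$y_0=0,\qquad y_t=\rho_t y_{t-1}+z_t\ (t\ge1),\qquad \rho_t=\rho+\sum_{j=1}^m\varepsilon_j\,\mathbf 1\{k_j(n)\le t\le k_j(n)+h_j-1\},$$ and let $B_n^{(j)}$ be the precision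 matrix of the $j$-th submodel, in which $\rho_t=\rho+\varepsilon_j\mathbf 1\{k_j(n)\le t\le k_j(n)+h_j-1\}$. For real symmetric $n\times n$ matrices $A_n$ ($n\ge1$) whose empirical spectral distributions converge weakly to a compactly supported probability measure $\mu$ (the asymptotic spectral distribution), $out(\{A_n\})$ is the set of $x\in\mathbb R$ that lie outside the closed support of $\mu$ and satisfy $\lim_{n\to\infty}\inf_{y\in spec(A_n)}|x-y|=0$. The multiplicity of $x\in out(\{A_n\})$ is the number of eigenvalues of $A_n$, counted with multiplicity, that converge to $x$: the largest $r$ such that every neighbourhood of $x$ contains at least $r$ eigenvalues of $A_n$ for all large $n$. Points that are not outliers have multiplicity $0$. Then $\{B_n\}$ and all the $\{B_n^{(j)}\}$ have one common asymptotic spectral distribution, and $$out(\{B_n\})=\bigcup_{j=1}^m out(\{B_n^{(j)}\}),$$ both as sets and as multisets: every $x\in\mathbb R$ has finite multiplicity in $out(\{B_n\})$, and this multiplicity is the sum over $j$ of its multiplicities in $out(\{B_n^{(j)}\})$. -/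

import Mathlib

open MeasureTheory ProbabilityTheory Filter Topology
open scoped NNReal ENNReal

namespace SCM

noncomputable section

/-! ## Time-varying autoregressive processes and their precision matrices -/

/-- `z₁, z₂, …` is a (weak) white noise with variance `σ2`: square integrable, centred, with
second moment `σ2`, and pairwise uncorrelated.  The variable `z 0` plays no role. -/
structure IsWhiteNoise {Ω : Type*} [MeasurableSpace Ω] (P : Measure Ω) (z : ℕ → Ω → ℝ)
    (σ2 : ℝ) : Prop where
  memLp : ∀ t, 1 ≤ t → MemLp (z t) 2 P
  mean_zero : ∀ t, 1 ≤ t → ∫ ω, z t ω ∂P = 0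
  second_moment : ∀ t, 1 ≤ t → ∫ ω, z t ω ^ 2 ∂P = σ2
  uncorrelated : ∀ s t, 1 ≤ s → 1 ≤ t → s ≠ t → cov[z s, z t; P] = 0

/-- The process `y₀ = 0`, `y_t = r_t y_{t-1} + z_t` for `t ≥ 1`. -/
def arProcess {Ω : Type*} (r : ℕ → ℝ) (z : ℕ → Ω → ℝ) : ℕ → Ω → ℝ
  | 0 => fun _ => 0
  | t + 1 => fun ω => r (t + 1) * arProcess r z t ω + z (t + 1) ω

/-- The covariance matrix of `(y₁, …, y_n)`. -/
def covMatrix {Ω : Type*} [MeasurableSpace Ω] (P : Measure Ω) (y : ℕ → Ω → ℝ) (n : ℕ) :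
    Matrix (Fin n) (Fin n) ℝ :=
  Matrix.of fun i j => cov[y (i + 1), y (j + 1); P]

theorem covMatrix_isHermitian {Ω : Type*} [MeasurableSpace Ω] (P : Measure Ω)
    (y : ℕ → Ω → ℝ) (n : ℕ) : (covMatrix P y n).IsHermitian := by
  ext i j
  simp [covMatrix, covariance_comm (y (j + 1)) (y (i + 1))]

/-- A sequence of real symmetric matrices, the `n`-th one of size `n × n`. -/
abbrev SymmSeq : Type := ∀ n : ℕ, {A : Matrix (Fin n) (Fin n) ℝ // A.IsHermitian}

/-- The coefficients `ρ_t = ρ + ∑ j, ε_j 1[k_j ≤ t ≤ k_j + h_j - 1]`. -/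
def scmCoeff (ρ : ℝ) {m : ℕ} (ε : Fin m → ℝ) (k h : Fin m → ℕ) (t : ℕ) : ℝ :=
  ρ + ∑ j, (Set.Ico (k j) (k j + h j)).indicator (fun _ => ε j) t

/-- The precision matrices `B_n = [var (y₁, …, y_n)]⁻¹` of the structural change model with
magnitudes `ε`, break points `k n` (these may move with the sample size `n`) and lengths `h`. -/
def scmPrecision {Ω : Type*} [MeasurableSpace Ω] (P : Measure Ω) (z : ℕ → Ω → ℝ) (ρ : ℝ)
    {m : ℕ} (ε : Fin m → ℝ) (k : ℕ → Fin m → ℕ) (h : Fin m → ℕ) : SymmSeq :=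
  fun n => ⟨(covMatrix P (arProcess (scmCoeff ρ ε (k n) h) z) n)⁻¹,
    (covMatrix_isHermitian P _ n).inv⟩

/-- The precision matrices of the `j`-th submodel, whose coefficients
`ρ + ε_j 1[k_j ≤ t ≤ k_j + h_j - 1]` keep only the `j`-th change. -/
def submodelPrecision {Ω : Type*} [MeasurableSpace Ω] (P : Measure Ω) (z : ℕ → Ω → ℝ) (ρ : ℝ)
    {m : ℕ} (ε : Fin m → ℝ) (k : ℕ → Fin m → ℕ) (h : Fin m → ℕ) (j : Fin m) : SymmSeq :=
  scmPrecision P z ρ (fun _ : Fin 1 => ε j) (fun n _ => k n j) (fun _ => h j)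

/-- The spacing `Δ_j = k_j - (k_{j-1} + h_{j-1} - 1)` between the end of the previous change and
the start of the `j`-th one; for the first change the previous end is `0`. -/
def spacing {m : ℕ} (k h : Fin m → ℕ) (j : Fin m) : ℤ :=
  if (j : ℕ) = 0 then (k j : ℤ)
  else
    let i : Fin m := ⟨(j : ℕ) - 1, (Nat.sub_le _ _).trans_lt j.isLt⟩
    (k j : ℤ) - ((k i : ℤ) + (h i : ℤ) - 1)

/-! ## Asymptotic spectral distributions and outliers -/

/-- The empirical spectral distribution `n⁻¹ ∑ i, δ_{λ_i}` of a real symmetric matrix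
(eigenvalues repeated according to multiplicity). -/
def esd {n : ℕ} (A : {A : Matrix (Fin n) (Fin n) ℝ // A.IsHermitian}) : FiniteMeasure ℝ :=
  (n : ℝ≥0)⁻¹ • ∑ i, (diracProba (A.2.eigenvalues i)).toFiniteMeasure

/-- `μ` is the asymptotic spectral distribution of `A`: it is a compactly supported probability
measure, and the empirical spectral distributions converge weakly to it. -/
structure IsASD (A : SymmSeq) (μ : ProbabilityMeasure ℝ) : Prop where
  isCompact_support : IsCompact (closure (μ : Measure ℝ).support)
  tendsto_esd : Tendsto (fun n => esd (A n)) atTop (𝓝 μ.toFiniteMeasure)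

/-- The set of outliers of `A`: the real numbers outside the closure of the support of the
asymptotic spectral distribution whose distance to the spectrum of `A n` tends to `0`. -/
def outlierSet (A : SymmSeq) : Set ℝ :=
  {x | ∃ μ : ProbabilityMeasure ℝ, IsASD A μ ∧
    Tendsto (fun n => Metric.infDist x (spectrum ℝ (A n).1)) atTop (𝓝 0) ∧
    x ∉ closure (μ : Measure ℝ).support}

/-- The number of eigenvalues (with multiplicity) of `A` at distance less than `δ` from `x`. -/
def eigenvalueCount {n : ℕ} (A : {A : Matrix (Fin n) (Fin n) ℝ // A.IsHermitian}) (x δ : ℝ) :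
    ℕ :=
  (Finset.univ.filter fun i => |x - A.2.eigenvalues i| < δ).card

open Classical in
/-- The multiplicity of `x` in the multiset of outliers of `A`.  It is `0` if `x` is not an outlier;
otherwise it is the number of eigenvalues of `A n`, counted with multiplicity, that
converge to `x`, that is, the largest `r` such that each neighbourhood of `x` contains at
least `r` eigenvalues of `A n` for all large `n`. -/
def outlierMult (A : SymmSeq) (x : ℝ) : ℕ∞ :=
  if x ∈ outlierSet A then
    ⨆ (r : ℕ) (_ : ∀ δ > 0, ∀ᶠ n in atTop, r ≤ eigenvalueCount (A n) x δ), (r : ℕ∞)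
  else 0

end

end SCM

namespace SCM

noncomputable section

/-! Write c = 1/σ² and let T be the bidiagonal matrix that turns the path into its innovations. Then
T var(y) Tᵀ = σ² I, so the precision matrix is c TᵀT (`inv_covMatrix_arProcess`). It is tridiagonal,
and each of its entries sees only the coefficients next to it.

With constant coefficient ρ, T differs from the identity by ρ times a shift. Hence the spectrum lies
in the bulk I = [c(1-|ρ|)², c(1+|ρ|)²] for every n, boundary included (`le_nrm_arMatrix_const_sub`).
Finitely many changes of fixed length alter the Toeplitz matrix by a bounded amount in the entrywise
ℓ¹ norm. So all models share the limiting law of the Toeplitz matrix, whose support is I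
(`isASD_arLaw`, `support_arLaw`).

Fix x outside I. Away from the breaks the matrix equals the unperturbed one, which is bounded below
at x, so approximate eigenvectors at x concentrate near the breaks. Multiplication by trapezoidal
cut-offs of width R around the breaks maps the full model to the direct sum of the submodels, and
the transpose maps back. Both maps intertwine the matrices up to O(1/R) and almost preserve the norm
of approximate eigenvectors. By dimension counting (`eigCount_le_of_intertwining`) the number of
eigenvalues within δ of x on one side is at most the number within 2δ on the other
(`LocalChanges.eigCount_le`, `LocalChanges.sum_eigCount_le`). Here R depends on δ but not on n.

Multiplicity is a lower limit in n, and lower limits are in general only superadditive. Every change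
but the last stays far from both ends, so the eigenvalue count of its submodel is essentially
independent of n (`eigCount_le_of_shift`). Only the last change may approach the end n, in a manner
that varies with n; a single unsettled summand does no harm to additivity
(`persistentCount_iff_le_sum`). -/

/-! ## Euclidean norms of coordinate vectors -/

/-- The Euclidean norm of a coordinate vector. -/
def nrm {ι : Type*} [Fintype ι] (v : ι → ℝ) : ℝ := ‖WithLp.toLp 2 v‖

section nrm

variable {ι κ : Type*} [Fintype ι] [Fintype κ]

theorem nrm_nonneg (v : ι → ℝ) : 0 ≤ nrm v := norm_nonneg _

theorem nrm_sq (v : ι → ℝ) : nrm v ^ 2 = ∑ i, v i ^ 2 := by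
  simp [nrm, EuclideanSpace.norm_sq_eq]

theorem nrm_add_le (v w : ι → ℝ) : nrm (v + w) ≤ nrm v + nrm w := by
  simpa [nrm] using norm_add_le (WithLp.toLp 2 v) (WithLp.toLp 2 w)

theorem nrm_sub_le (v w : ι → ℝ) : nrm (v - w) ≤ nrm v + nrm w := by
  simpa [nrm] using norm_sub_le (WithLp.toLp 2 v) (WithLp.toLp 2 w)

theorem nrm_smul (c : ℝ) (v : ι → ℝ) : nrm (c • v) = |c| * nrm v := by
  simp [nrm, norm_smul]

theorem nrm_pos {v : ι → ℝ} (hv : v ≠ 0) : 0 < nrm v := by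
  rw [nrm, norm_pos_iff]; simpa using hv

theorem nrm_le_of_sq_le {v : ι → ℝ} {c : ℝ} (hc : 0 ≤ c) (h : ∑ i, v i ^ 2 ≤ c ^ 2) :
    nrm v ≤ c := by
  rw [← nrm_sq] at h
  exact le_of_sq_le_sq h hc

theorem nrm_mono {v w : ι → ℝ} (h : ∀ i, |v i| ≤ |w i|) : nrm v ≤ nrm w := by
  refine nrm_le_of_sq_le (nrm_nonneg w) ?_
  rw [nrm_sq]
  exact Finset.sum_le_sum fun i _ => sq_le_sq.2 (h i)

theorem dotProduct_le_nrm (v w : ι → ℝ) : v ⬝ᵥ w ≤ nrm v * nrm w := by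
  refine le_of_sq_le_sq ?_ (mul_nonneg (nrm_nonneg v) (nrm_nonneg w))
  rw [mul_pow, nrm_sq, nrm_sq]
  exact Finset.sum_mul_sq_le_sq_mul_sq _ _ _

/-- Schur's test. -/
theorem nrm_mulVec_le_of_sum_le (E : Matrix κ ι ℝ) {c : ℝ} (hc : 0 ≤ c)
    (hrow : ∀ a, ∑ b, |E a b| ≤ c) (hcol : ∀ b, ∑ a, |E a b| ≤ c) (v : ι → ℝ) :
    nrm (E.mulVec v) ≤ c * nrm v := by
  refine nrm_le_of_sq_le (mul_nonneg hc (nrm_nonneg v)) ?_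
  have h1 : ∀ a, (E.mulVec v) a ^ 2 ≤ c * ∑ b, |E a b| * v b ^ 2 := fun a => by
    -- Cauchy–Schwarz with the weights |E a b|; the row sum is then bounded by c, and the column
    -- sums enter after exchanging the summations.
    have h := Finset.sum_sq_le_sum_mul_sum_of_sq_le_mul Finset.univ (r := fun b => E a b * v b)
      (f := fun b => |E a b|) (g := fun b => |E a b| * v b ^ 2) (fun _ _ => abs_nonneg _)
      (fun _ _ => by positivity) (fun b _ => by rw [mul_pow, ← sq_abs (E a b)]; exact (by ring : _ = _).le)
    refine h.trans (mul_le_mul_of_nonneg_right (hrow a) ?_)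
    exact Finset.sum_nonneg fun _ _ => by positivity
  calc ∑ a, (E.mulVec v) a ^ 2 ≤ ∑ a, c * ∑ b, |E a b| * v b ^ 2 :=
        Finset.sum_le_sum fun a _ => h1 a
    _ = c * ∑ b, (∑ a, |E a b|) * v b ^ 2 := by
        rw [← Finset.mul_sum, Finset.sum_comm]; simp_rw [Finset.sum_mul]
    _ ≤ c * ∑ b, c * v b ^ 2 := by
        refine mul_le_mul_of_nonneg_left (Finset.sum_le_sum fun b _ => ?_) hc
        exact mul_le_mul_of_nonneg_right (hcol b) (sq_nonneg _)
    _ = (c * nrm v) ^ 2 := by rw [← Finset.mul_sum, mul_pow, nrm_sq]; ring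

end nrm

/-! ## Counting eigenvalues near a point -/

/-- The number of eigenvalues of `A`, with multiplicity, at distance less than `δ` from `x`. -/
def eigCount {ι : Type*} [Fintype ι] [DecidableEq ι] (A : Matrix ι ι ℝ) (x δ : ℝ) : ℕ :=
  (A.charpoly.roots.filter fun y => |x - y| < δ).card

section eigCount

variable {ι κ : Type*} [Fintype ι] [DecidableEq ι] [Fintype κ] [DecidableEq κ]

theorem eigCount_eq_card {A : Matrix ι ι ℝ} (hA : A.IsHermitian) (x δ : ℝ) :
    eigCount A x δ = (Finset.univ.filter fun i => |x - hA.eigenvalues i| < δ).card := by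
  rw [eigCount, hA.roots_charpoly_eq_eigenvalues, Multiset.filter_map, Multiset.card_map]
  rfl

theorem eigenvalueCount_eq_eigCount {n : ℕ}
    (A : {A : Matrix (Fin n) (Fin n) ℝ // A.IsHermitian}) (x δ : ℝ) :
    eigenvalueCount A x δ = eigCount A.1 x δ :=
  (eigCount_eq_card A.2 x δ).symm

theorem eigCount_mono (A : Matrix ι ι ℝ) (x : ℝ) {δ δ' : ℝ} (h : δ ≤ δ') :
    eigCount A x δ ≤ eigCount A x δ' :=
  Multiset.card_le_card (Multiset.monotone_filter_right _ fun _ hb => hb.trans_le h)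

/-- Characteristic polynomials of blocks multiply, so their root multisets add. This allows the
family of submodels to be compared with the full model as one matrix. -/
theorem eigCount_blockDiagonal (A : κ → Matrix ι ι ℝ) (x δ : ℝ) :
    eigCount (Matrix.blockDiagonal A) x δ = ∑ j, eigCount (A j) x δ := by
  have h : (Matrix.blockDiagonal A).charpoly = ∏ j, (A j).charpoly := by
    have h1 : (Matrix.blockDiagonal A).charmatrix =
        Matrix.blockDiagonal fun j => (A j).charmatrix := by
      ext1 ⟨i, j⟩ ⟨i', j'⟩
      by_cases hj : j = j'
      · subst hj
        by_cases hi : i = i'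
        · subst hi; simp
        · simp [Matrix.blockDiagonal_apply, hi]
      · simp [Matrix.blockDiagonal_apply, hj]
    rw [Matrix.charpoly, h1, Matrix.det_blockDiagonal]
    rfl
  rw [eigCount, h, Polynomial.roots_prod _ _
    (Finset.prod_ne_zero_iff.2 fun j _ => (Matrix.charpoly_monic (A j)).ne_zero)]
  simp only [eigCount, Multiset.bind, Multiset.join]
  induction (Finset.univ : Finset κ) using Finset.induction_on with
  | empty => simp
  | insert a s ha ih =>
    rw [Finset.sum_insert ha, Finset.insert_val, Multiset.ndinsert_of_notMem ha]
    simpa [Multiset.filter_add] using ih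

/-- Coordinates of a vector in an orthonormal basis of eigenvectors. -/
theorem exists_spectral_coordinates {A : Matrix ι ι ℝ} (hA : A.IsHermitian) :
    ∃ Φ : (ι → ℝ) ≃ₗ[ℝ] (ι → ℝ), (∀ v, nrm (Φ v) = nrm v) ∧
      ∀ v i, Φ (A.mulVec v) i = hA.eigenvalues i * Φ v i := by
  let b := hA.eigenvectorBasis
  refine ⟨(WithLp.linearEquiv 2 ℝ (ι → ℝ)).symm ≪≫ₗ b.repr.toLinearEquiv ≪≫ₗ
    WithLp.linearEquiv 2 ℝ (ι → ℝ), fun v => ?_, fun v i => ?_⟩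
  · simp [nrm]
  · have h1 : ∀ w : ι → ℝ, b.repr (WithLp.toLp 2 w) i = w ⬝ᵥ ⇑(b i) := fun w => by
      rw [b.repr_apply_apply, PiLp.inner_apply]
      simp [dotProduct]
    simp only [LinearEquiv.trans_apply]
    change b.repr (WithLp.toLp 2 (A.mulVec v)) i = _ * b.repr (WithLp.toLp 2 v) i
    rw [h1, h1, dotProduct_comm, Matrix.dotProduct_mulVec, ← Matrix.mulVec_transpose]
    have hT : A.transpose = A := by simpa [Matrix.IsHermitian] using hA
    rw [hT, hA.mulVec_eigenvectorBasis, smul_dotProduct, dotProduct_comm]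
    rfl

/-- Parseval in the eigenbasis; both dimension counts below read the distance of the spectrum to x
from this sum. -/
theorem nrm_sub_smul_sq {A : Matrix ι ι ℝ} (hA : A.IsHermitian) {Φ : (ι → ℝ) ≃ₗ[ℝ] (ι → ℝ)}
    (hΦ : ∀ v, nrm (Φ v) = nrm v) (hΦA : ∀ v i, Φ (A.mulVec v) i = hA.eigenvalues i * Φ v i)
    (x : ℝ) (v : ι → ℝ) :
    nrm (A.mulVec v - x • v) ^ 2 = ∑ i, (x - hA.eigenvalues i) ^ 2 * Φ v i ^ 2 := by
  rw [← hΦ, nrm_sq]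
  refine Finset.sum_congr rfl fun i _ => ?_
  rw [map_sub, Pi.sub_apply, hΦA, map_smul, Pi.smul_apply, smul_eq_mul]
  ring

/-- Fewer linear conditions than eigenvalues near `x` leave an approximate eigenvector. -/
theorem exists_approx_eigenvector {A : Matrix ι ι ℝ} (hA : A.IsHermitian) {x δ : ℝ} {F : Type*}
    [AddCommGroup F] [Module ℝ F] [FiniteDimensional ℝ F] (L : (ι → ℝ) →ₗ[ℝ] F)
    (hF : Module.finrank ℝ F < eigCount A x δ) :
    ∃ v, v ≠ 0 ∧ L v = 0 ∧ nrm (A.mulVec v - x • v) < δ * nrm v := by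
  obtain ⟨Φ, hΦ, hΦA⟩ := exists_spectral_coordinates hA
  let p : ι → Prop := fun i => |x - hA.eigenvalues i| < δ
  let ext : ({i // p i} → ℝ) →ₗ[ℝ] (ι → ℝ) :=
    Function.ExtendByZero.linearMap ℝ (Subtype.val : {i // p i} → ι)
  have hcard : Module.finrank ℝ F < Module.finrank ℝ ({i // p i} → ℝ) := by
    rw [Module.finrank_fintype_fun_eq_card, Fintype.card_subtype]
    rwa [eigCount_eq_card hA] at hF
  -- The combinations of eigenvectors with eigenvalue near x form a space too large for the
  -- conditions `L` to be injective on it.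
  obtain ⟨u, hu, hu0⟩ := (Submodule.ne_bot_iff _).1
    (LinearMap.ker_ne_bot_of_finrank_lt (f := L ∘ₗ Φ.symm.toLinearMap ∘ₗ ext) hcard)
  have hpos : 0 < δ := by
    by_contra hδ
    refine hu0 (funext fun i => absurd i.2 ?_)
    exact not_lt.2 ((not_lt.1 hδ).trans (abs_nonneg _))
  have hext : ∀ i : {i // p i}, ext u i = u i := fun i =>
    Subtype.val_injective.extend_apply u 0 i
  have hext0 : ∀ i, ¬ p i → ext u i = 0 := fun i hi =>
    Function.extend_apply' (f := (Subtype.val : {i // p i} → ι)) u (0 : ι → ℝ) i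
      (by rintro ⟨a, rfl⟩; exact hi a.2)
  have hne : ext u ≠ 0 := fun h => hu0 (funext fun i => by rw [← hext, h]; rfl)
  refine ⟨Φ.symm (ext u), by simpa using hne, by simpa using hu, ?_⟩
  refine lt_of_pow_lt_pow_left₀ 2 (mul_nonneg hpos.le (nrm_nonneg _)) ?_
  rw [nrm_sub_smul_sq hA hΦ hΦA, mul_pow, ← hΦ (Φ.symm _), nrm_sq, Finset.mul_sum,
    LinearEquiv.apply_symm_apply]
  obtain ⟨i, hi⟩ := Function.ne_iff.1 hne
  have hlt : ∀ i, p i → (x - hA.eigenvalues i) ^ 2 < δ ^ 2 := fun i hi =>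
    sq_lt_sq.2 (by rwa [abs_of_pos hpos])
  refine Finset.sum_lt_sum (fun i _ => ?_) ⟨i, Finset.mem_univ _, ?_⟩
  · by_cases hp : p i
    · exact mul_le_mul_of_nonneg_right (hlt i hp).le (sq_nonneg _)
    · simp [hext0 i hp]
  · have hp : p i := by
      by_contra hp
      exact hi (hext0 i hp)
    have hi' : ext u i ≠ 0 := hi
    exact mul_lt_mul_of_pos_right (hlt i hp) (by positivity)

/-- The spectral projection onto the eigenvalues near `x`, as `eigCount A x δ` conditions. -/
theorem exists_spectral_conditions {A : Matrix ι ι ℝ} (hA : A.IsHermitian) (x : ℝ) {δ : ℝ}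
    (hδ : 0 ≤ δ) :
    ∃ L : (ι → ℝ) →ₗ[ℝ] (Fin (eigCount A x δ) → ℝ),
      ∀ v, L v = 0 → δ * nrm v ≤ nrm (A.mulVec v - x • v) := by
  obtain ⟨Φ, hΦ, hΦA⟩ := exists_spectral_coordinates hA
  let p : ι → Prop := fun i => |x - hA.eigenvalues i| < δ
  have hc : Fintype.card {i // p i} = eigCount A x δ := by
    rw [Fintype.card_subtype, eigCount_eq_card hA]
  let e : Fin (eigCount A x δ) ≃ {i // p i} := (Fintype.equivFinOfCardEq hc).symm
  refine ⟨LinearMap.funLeft ℝ ℝ (fun i => (e i : ι)) ∘ₗ Φ.toLinearMap, fun v hv => ?_⟩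
  have h0 : ∀ i, p i → Φ v i = 0 := fun i hi => by
    have h := congrFun hv (e.symm ⟨i, hi⟩)
    simpa [LinearMap.funLeft_apply] using h
  refine le_of_sq_le_sq ?_ (nrm_nonneg _)
  rw [nrm_sub_smul_sq hA hΦ hΦA, mul_pow, ← hΦ v, nrm_sq, Finset.mul_sum]
  refine Finset.sum_le_sum fun i _ => ?_
  by_cases hp : p i
  · simp [h0 i hp]
  · refine mul_le_mul_of_nonneg_right (sq_le_sq.2 ?_) (sq_nonneg _)
    rw [abs_of_nonneg hδ]
    exact not_lt.1 hp

/-- If `J` almost intertwines `A` and `A'` and is almost isometric on approximate eigenvectors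
of `A`, then `A'` has at least as many eigenvalues near `x` as `A`. -/
theorem eigCount_le_of_intertwining {A : Matrix ι ι ℝ} (hA : A.IsHermitian) {A' : Matrix κ κ ℝ}
    (hA' : A'.IsHermitian) (J : Matrix κ ι ℝ) {x δ η C : ℝ} (hδ : 0 < δ)
    (hC : 0 ≤ C) (hCδ : C * (δ + η) ≤ 1 / 4) (hηδ : η ≤ δ / 4)
    (h1 : ∀ v, nrm (J.mulVec v) ≤ nrm v)
    (h2 : ∀ v, nrm (A'.mulVec (J.mulVec v) - J.mulVec (A.mulVec v)) ≤ η * nrm v)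
    (h3 : ∀ v, nrm v ≤ nrm (J.mulVec v) + C * (nrm (A.mulVec v - x • v) + η * nrm v)) :
    eigCount A x δ ≤ eigCount A' x (2 * δ) := by
  -- If `A'` had fewer eigenvalues near x, the conditions for J v to be orthogonal to their
  -- eigenvectors could be imposed on an approximate eigenvector v of `A`.
  by_contra! hlt
  obtain ⟨L, hL⟩ := exists_spectral_conditions hA' x (δ := 2 * δ) (by positivity)
  obtain ⟨v, hv0, hv, hvδ⟩ := exists_approx_eigenvector hA (L ∘ₗ J.mulVecLin) (x := x) (δ := δ)
    (by simpa using hlt)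
  have h4 := hL (J.mulVec v) (by simpa using hv)
  have hv1 := nrm_pos hv0
  have h5 : nrm (A'.mulVec (J.mulVec v) - x • J.mulVec v) ≤
      η * nrm v + nrm (A.mulVec v - x • v) := by
    have : A'.mulVec (J.mulVec v) - x • J.mulVec v =
        (A'.mulVec (J.mulVec v) - J.mulVec (A.mulVec v)) + J.mulVec (A.mulVec v - x • v) := by
      rw [Matrix.mulVec_sub, Matrix.mulVec_smul]; abel
    rw [this]
    exact (nrm_add_le _ _).trans (add_le_add (h2 v) (h1 _))
  have h6 : C * (nrm (A.mulVec v - x • v) + η * nrm v) ≤ 1 / 4 * nrm v := by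
    calc _ ≤ C * (δ * nrm v + η * nrm v) := by gcongr
      _ = C * (δ + η) * nrm v := by ring
      _ ≤ _ := by gcongr
  have h7 := h3 v
  have h8 : η * nrm v ≤ δ / 4 * nrm v := by gcongr
  -- By `h3`, J v keeps 3/4 of the norm of v, so orthogonality forces the residual of J v to be at
  -- least (3/2)δ‖v‖. But `h5` bounds it by (δ + η)‖v‖ ≤ (5/4)δ‖v‖.
  have h9 : 2 * δ * (3 / 4 * nrm v) ≤ 2 * δ * nrm (J.mulVec v) := by
    gcongr; linarith
  nlinarith [mul_pos hδ hv1]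

/-- If `A - x` is bounded below on the vectors that vanish on `S`, then at most `|S|` eigenvalues
of `A` are close to `x`. -/
theorem eigCount_le_card {A : Matrix ι ι ℝ} (hA : A.IsHermitian) {x δ : ℝ} (S : Finset ι)
    (h : ∀ v : ι → ℝ, (∀ i ∈ S, v i = 0) → δ * nrm v ≤ nrm (A.mulVec v - x • v)) :
    eigCount A x δ ≤ S.card := by
  by_contra! hlt
  obtain ⟨v, -, hv, hvδ⟩ := exists_approx_eigenvector hA
    (LinearMap.funLeft ℝ ℝ (Subtype.val : S → ι)) (x := x) (δ := δ) (by simpa using hlt)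
  exact absurd (h v fun i hi => congrFun hv ⟨i, hi⟩) (not_le.2 hvδ)

end eigCount

/-! ## The precision matrix is tridiagonal -/

/-- The entries of `1 - s S`, with `S` the shift. -/
def diffEntry (s : ℕ → ℝ) (i a : ℕ) : ℝ :=
  (if a = i then 1 else 0) - (if i = a + 1 then s i else 0)

/-- The matrix that sends a path to its innovations. -/
def diffMatrix (s : ℕ → ℝ) (n : ℕ) : Matrix (Fin n) (Fin n) ℝ :=
  Matrix.of fun i a => diffEntry s i a

/-- The entries of `c (1 - s S)ᵀ (1 - s S)`, with `S` the shift. -/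
def arEntry (c : ℝ) (s : ℕ → ℝ) (a b : ℕ) : ℝ :=
  c * ((if a = b then 1 + s (a + 1) ^ 2 else 0) - (if b = a + 1 then s b else 0) -
    (if a = b + 1 then s a else 0))

/-- The coefficients `s`, set to zero from `n` on. -/
def cutAt (s : ℕ → ℝ) (n i : ℕ) : ℝ := if i < n then s i else 0

/-- The precision matrix of an autoregression with coefficients `s 1, …, s (n - 1)`. -/
def arMatrix (c : ℝ) (s : ℕ → ℝ) (n : ℕ) : Matrix (Fin n) (Fin n) ℝ :=
  Matrix.of fun a b => arEntry c (cutAt s n) a b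

theorem arEntry_comm (c : ℝ) (s : ℕ → ℝ) (a b : ℕ) : arEntry c s a b = arEntry c s b a := by
  unfold arEntry
  by_cases h : a = b
  · subst h; rfl
  · simp only [h, Ne.symm h, if_false]; ring

theorem arMatrix_isHermitian (c : ℝ) (s : ℕ → ℝ) (n : ℕ) : (arMatrix c s n).IsHermitian := by
  ext a b
  simp [arMatrix, arEntry_comm c _ (b : ℕ)]

/-- Column a of the bidiagonal matrix has the entries 1 in row a and -s (a+1) in row a+1. The second
is missing for a + 1 = n, since the innovation after the sample end is not observed; `cutAt` records
this in the last diagonal entry. -/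
theorem smul_diffMatrix_transpose_mul (c : ℝ) (s : ℕ → ℝ) (n : ℕ) :
    c • ((diffMatrix s n).transpose * diffMatrix s n) = arMatrix c s n := by
  ext a b
  simp only [Matrix.smul_apply, smul_eq_mul, Matrix.mul_apply, Matrix.transpose_apply, diffMatrix,
    arMatrix, Matrix.of_apply, arEntry]
  congr 1
  rw [Fin.sum_univ_eq_sum_range (fun i => diffEntry s i a * diffEntry s i b) n]
  have ha := a.2
  have hb := b.2
  have h : ∀ i, diffEntry s i a * diffEntry s i b =
      (if (a : ℕ) = i then diffEntry s a b else 0) -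
      (if (a : ℕ) + 1 = i then s (a + 1) * diffEntry s (a + 1) b else 0) := fun i => by
    by_cases h1 : (a : ℕ) = i
    · subst h1; simp [diffEntry]
    · by_cases h2 : (a : ℕ) + 1 = i
      · subst h2; simp [diffEntry]
      · have h2' : ¬ i = (a : ℕ) + 1 := fun h => h2 h.symm
        simp [diffEntry, h1, h2, h2']
  rw [Finset.sum_congr rfl fun i _ => h i]
  simp only [Finset.sum_sub_distrib, Finset.sum_ite_eq, Finset.mem_range, ha, if_true]
  clear h
  generalize (a : ℕ) = a at *
  generalize (b : ℕ) = b at *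
  unfold diffEntry cutAt
  by_cases hab : a = b
  · subst hab; split_ifs <;> first | omega | ring
  · by_cases hb' : b = a + 1
    · subst hb'; split_ifs <;> first | omega | ring
    · split_ifs <;> first | omega | ring

/-- Row 0 has no subdiagonal entry; the initial value g 0 = 0 makes the formula uniform. -/
theorem sum_diffEntry_mul (s : ℕ → ℝ) {n : ℕ} (i : Fin n) (g : ℕ → ℝ) (hg : g 0 = 0) :
    ∑ a : Fin n, diffEntry s i a * g (a + 1) = g (i + 1) - s i * g i := by
  rw [Fin.sum_univ_eq_sum_range (fun a => diffEntry s i a * g (a + 1)) n]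
  obtain ⟨i, hi⟩ := i
  simp only [diffEntry, sub_mul, ite_mul, one_mul, zero_mul, Finset.sum_sub_distrib,
    Finset.sum_ite_eq', Finset.mem_range, hi, if_true]
  congr 1
  rcases i with _ | i
  · simp [hg]
  · simp only [add_left_inj]
    rw [Finset.sum_ite_eq, if_pos (Finset.mem_range.2 (by omega))]

theorem memLp_arProcess {Ω : Type*} [MeasurableSpace Ω] {P : Measure Ω} {z : ℕ → Ω → ℝ}
    {σ2 : ℝ} (hz : IsWhiteNoise P z σ2) (r : ℕ → ℝ) (t : ℕ) : MemLp (arProcess r z t) 2 P := by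
  induction t with
  | zero => exact MemLp.zero
  | succ t ih => exact (ih.const_mul (r (t + 1))).add (hz.memLp (t + 1) (by omega))

theorem IsWhiteNoise.covariance_eq {Ω : Type*} [MeasurableSpace Ω] {P : Measure Ω}
    [IsProbabilityMeasure P] {z : ℕ → Ω → ℝ} {σ2 : ℝ} (hz : IsWhiteNoise P z σ2) (i j : ℕ) :
    cov[z (i + 1), z (j + 1); P] = if i = j then σ2 else 0 := by
  split_ifs with h
  · subst h
    rw [covariance_eq_sub (hz.memLp _ (by omega)) (hz.memLp _ (by omega)),
      hz.mean_zero _ (by omega), ← hz.second_moment (i + 1) (by omega)]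
    simp [sq]
  · exact hz.uncorrelated _ _ (by omega) (by omega) (by omega)

/-- The innovations are T y, so bilinearity of the covariance gives T K Tᵀ = σ² I. Row i, counted
from 0, carries the innovation at time i + 1, whence the coefficient r (i + 1). -/
theorem inv_covMatrix_arProcess {Ω : Type*} [MeasurableSpace Ω] {P : Measure Ω}
    [IsProbabilityMeasure P] {z : ℕ → Ω → ℝ} {σ2 : ℝ} (hσ2 : 0 < σ2) (hz : IsWhiteNoise P z σ2)
    (r : ℕ → ℝ) (n : ℕ) :
    (covMatrix P (arProcess r z) n)⁻¹ = arMatrix σ2⁻¹ (fun i => r (i + 1)) n := by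
  set T := diffMatrix (fun i => r (i + 1)) n with hT
  set K := covMatrix P (arProcess r z) n with hK
  have hinn : ∀ i : Fin n, (fun ω => ∑ a : Fin n,
      diffEntry (fun i => r (i + 1)) i a * arProcess r z (a + 1) ω) = z (i + 1) := fun i => by
    funext ω
    rw [sum_diffEntry_mul (fun i => r (i + 1)) i (fun t => arProcess r z t ω) rfl, arProcess]
    ring
  have h1 : T * K * T.transpose = σ2 • (1 : Matrix (Fin n) (Fin n) ℝ) := by
    ext i j
    have hc := hz.covariance_eq i j
    rw [← hinn i, ← hinn j, covariance_fun_sum_fun_sum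
      (fun a => (memLp_arProcess hz r _).const_mul _)
      (fun a => (memLp_arProcess hz r _).const_mul _)] at hc
    simp only [covariance_const_mul_left, covariance_const_mul_right] at hc
    rw [Matrix.smul_apply, Matrix.one_apply, smul_eq_mul, mul_ite, mul_one, mul_zero]
    simp only [Fin.ext_iff]
    rw [← hc, Matrix.mul_apply]
    simp only [Matrix.mul_apply, Matrix.transpose_apply, Finset.sum_mul]
    rw [Finset.sum_comm]
    refine Finset.sum_congr rfl fun a _ => Finset.sum_congr rfl fun b _ => ?_
    simp only [hT, hK, diffMatrix, covMatrix, Matrix.of_apply]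
    ring
  have h2 : T * (σ2⁻¹ • (K * T.transpose)) = 1 := by
    rw [Matrix.mul_smul, ← Matrix.mul_assoc, h1, smul_smul, inv_mul_cancel₀ hσ2.ne', one_smul]
  rw [← smul_diffMatrix_transpose_mul]
  refine Matrix.inv_eq_right_inv ?_
  -- For square matrices the right inverse of T is also a left inverse; this moves T behind K and
  -- yields K · (σ⁻² TᵀT) = 1.
  rw [mul_eq_one_comm, Matrix.smul_mul, Matrix.mul_assoc] at h2
  rw [Matrix.mul_smul, ← Matrix.mul_assoc, ← Matrix.smul_mul]
  rw [← hT]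
  simpa [Matrix.mul_assoc] using h2

/-! ## The unperturbed model has no outliers -/

theorem sum_abs_ite_le {ι : Type*} [Fintype ι] (p : ι → Prop) [DecidablePred p]
    (hp : ∀ i j, p i → p j → i = j) (f : ι → ℝ) {c : ℝ} (hc : 0 ≤ c) (hf : ∀ i, |f i| ≤ c) :
    ∑ i, |if p i then f i else 0| ≤ c := by
  by_cases h : ∃ i, p i
  · obtain ⟨i, hi⟩ := h
    rw [Finset.sum_eq_single i]
    · simpa [hi] using hf i
    · intro j _ hj
      simp [show ¬ p j from fun h => hj (hp _ _ h hi)]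
    · simp
  · push Not at h
    simpa [h] using hc

theorem nrm_diffMatrix_mulVec_sub_le (ρ : ℝ) (n : ℕ) (v : Fin n → ℝ) :
    nrm (v - (diffMatrix (fun _ => ρ) n).mulVec v) ≤ |ρ| * nrm v := by
  have h : v - (diffMatrix (fun _ => ρ) n).mulVec v =
      (Matrix.of fun i a : Fin n => if (i : ℕ) = a + 1 then ρ else 0).mulVec v := by
    have h1 : diffMatrix (fun _ => ρ) n =
        1 - (Matrix.of fun i a : Fin n => if (i : ℕ) = a + 1 then ρ else 0) := by
      ext i a
      simp [diffMatrix, diffEntry, Matrix.one_apply, Fin.ext_iff, eq_comm]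
    rw [h1, Matrix.sub_mulVec, Matrix.one_mulVec]
    abel
  rw [h]
  refine nrm_mulVec_le_of_sum_le _ (abs_nonneg ρ) (fun a => ?_) (fun b => ?_) v
  · exact sum_abs_ite_le (fun i : Fin n => (a : ℕ) = i + 1) (fun i j _ _ => by
      apply Fin.ext; omega) (fun _ => ρ) (abs_nonneg ρ) fun _ => le_rfl
  · exact sum_abs_ite_le (fun i : Fin n => (i : ℕ) = b + 1) (fun i j _ _ => by
      apply Fin.ext; omega) (fun _ => ρ) (abs_nonneg ρ) fun _ => le_rfl

theorem dotProduct_arMatrix_mulVec (c : ℝ) (s : ℕ → ℝ) (n : ℕ) (v : Fin n → ℝ) :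
    v ⬝ᵥ (arMatrix c s n).mulVec v = c * nrm ((diffMatrix s n).mulVec v) ^ 2 := by
  rw [← smul_diffMatrix_transpose_mul, Matrix.smul_mulVec, dotProduct_smul, ← Matrix.mulVec_mulVec,
    Matrix.dotProduct_mulVec, Matrix.vecMul_transpose, nrm_sq, smul_eq_mul]
  simp [dotProduct, sq]

/-- The spectrum of the precision matrix of a stationary autoregression is contained in
`[c (1 - |ρ|)², c (1 + |ρ|)²]`. -/
theorem le_nrm_arMatrix_const_sub {c ρ : ℝ} (hc : 0 ≤ c) (hρ : |ρ| ≤ 1) {x d : ℝ}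
    (hd : x + d ≤ c * (1 - |ρ|) ^ 2 ∨ c * (1 + |ρ|) ^ 2 + d ≤ x) (n : ℕ) (v : Fin n → ℝ) :
    d * nrm v ≤ nrm ((arMatrix c (fun _ => ρ) n).mulVec v - x • v) := by
  set A := arMatrix c (fun _ => ρ) n
  set w := (diffMatrix (fun _ => ρ) n).mulVec v with hw
  have hv := nrm_nonneg v
  have h0 := nrm_diffMatrix_mulVec_sub_le ρ n v
  rw [← hw] at h0
  have h1 : nrm w ≤ (1 + |ρ|) * nrm v := by
    have := nrm_sub_le v (v - w)
    rw [sub_sub_cancel] at this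
    linarith
  have h2 : (1 - |ρ|) * nrm v ≤ nrm w := by
    have := nrm_add_le w (v - w)
    rw [add_sub_cancel] at this
    linarith
  have h1' : nrm w ^ 2 ≤ (1 + |ρ|) ^ 2 * nrm v ^ 2 := by
    rw [← mul_pow]; exact pow_le_pow_left₀ (nrm_nonneg w) h1 2
  have h2' : (1 - |ρ|) ^ 2 * nrm v ^ 2 ≤ nrm w ^ 2 := by
    rw [← mul_pow]; exact pow_le_pow_left₀ (mul_nonneg (by linarith) hv) h2 2
  have h3 : v ⬝ᵥ (A.mulVec v - x • v) = c * nrm w ^ 2 - x * nrm v ^ 2 := by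
    rw [dotProduct_sub, dotProduct_arMatrix_mulVec, dotProduct_smul, nrm_sq v, smul_eq_mul]
    simp [dotProduct, sq, hw]
  -- The quadratic form of A - x is definite with gap d: positive below the bulk, negative above it,
  -- where the test vector is -v.
  have h4 : d * nrm v ^ 2 ≤ nrm v * nrm (A.mulVec v - x • v) := by
    rcases hd with hd | hd
    · have := dotProduct_le_nrm v (A.mulVec v - x • v)
      rw [h3] at this
      nlinarith [mul_le_mul_of_nonneg_left h2' hc, sq_nonneg (nrm v)]
    · have := dotProduct_le_nrm (-v) (A.mulVec v - x • v)
      rw [neg_dotProduct, h3] at this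
      have hneg : nrm (-v) = nrm v := by simpa using nrm_smul (-1) v
      rw [hneg] at this
      nlinarith [mul_le_mul_of_nonneg_left h1' hc, sq_nonneg (nrm v)]
  rcases hv.eq_or_lt with h | h
  · rw [← h]; simpa using nrm_nonneg _
  · exact le_of_mul_le_mul_left (by linarith [h4, sq (nrm v)]) h

/-! ## Localization by cut-offs -/

/-- Row a involves no coefficients but s a and s (a+1), and otherwise only the offset b - a. This
gives both the locality of the model and its translation invariance. -/
theorem arEntry_congr (c : ℝ) {f g : ℕ → ℝ} {a a' : ℕ} (h0 : f a = g a')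
    (h1 : f (a + 1) = g (a' + 1)) {b b' : ℕ} (hb : (a : ℤ) - a' = b - b') :
    arEntry c f a b = arEntry c g a' b' := by
  unfold arEntry
  have e1 : a = b ↔ a' = b' := by omega
  have e2 : b = a + 1 ↔ b' = a' + 1 := by omega
  have e3 : a = b + 1 ↔ a' = b' + 1 := by omega
  simp only [e1, e2, e3, h0, h1]
  congr 3
  by_cases h : b' = a' + 1
  · rw [if_pos h, if_pos h, h, e2.2 h, h1]
  · rw [if_neg h, if_neg h]

theorem arEntry_eq_zero (c : ℝ) (s : ℕ → ℝ) {a b : ℕ} (h : ¬ |(a : ℤ) - b| ≤ 1) :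
    arEntry c s a b = 0 := by
  rw [abs_le] at h
  unfold arEntry
  rw [if_neg (by omega), if_neg (by omega), if_neg (by omega)]
  ring

theorem abs_arEntry_le {c S : ℝ} (hc : 0 ≤ c) {s : ℕ → ℝ} (hs : ∀ t, |s t| ≤ S) (a b : ℕ) :
    |arEntry c s a b| ≤ c * (1 + S) ^ 2 := by
  have hS : 0 ≤ S := (abs_nonneg _).trans (hs 0)
  unfold arEntry
  rw [abs_mul, abs_of_nonneg hc]
  refine mul_le_mul_of_nonneg_left ?_ hc
  have h1 : |s (a + 1) ^ 2| ≤ S ^ 2 := by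
    rw [abs_pow]; exact pow_le_pow_left₀ (abs_nonneg _) (hs _) 2
  have ha := abs_le.1 (hs a)
  have hb := abs_le.1 (hs b)
  rw [abs_le] at h1 ⊢
  split_ifs <;> first | omega | (constructor <;> nlinarith)

theorem abs_cutAt_le {S : ℝ} {s : ℕ → ℝ} (hs : ∀ t, |s t| ≤ S) (n t : ℕ) :
    |cutAt s n t| ≤ S := by
  unfold cutAt
  split_ifs
  · exact hs t
  · simpa using (abs_nonneg _).trans (hs 0)

/-- The trapezoidal cut-off around `k`, with plateau `[k - R, k + R]` and support
`[k - 2 R, k + 2 R]`. -/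
def cutoff (R k a : ℕ) : ℝ := max 0 (min 1 (2 - |(a : ℝ) - k| / R))

theorem cutoff_nonneg (R k a : ℕ) : 0 ≤ cutoff R k a := le_max_left _ _

theorem cutoff_le_one (R k a : ℕ) : cutoff R k a ≤ 1 :=
  max_le zero_le_one (min_le_left _ _)

theorem cutoff_eq_one {R k a : ℕ} (h : |(a : ℤ) - k| ≤ R) : cutoff R k a = 1 := by
  have h' : |(a : ℝ) - k| ≤ R := by exact_mod_cast h
  have : |(a : ℝ) - k| / R ≤ 1 := div_le_one_of_le₀ h' (Nat.cast_nonneg R)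
  rw [cutoff, min_eq_left (by linarith), max_eq_right zero_le_one]

theorem cutoff_eq_zero {R k a : ℕ} (hR : 1 ≤ R) (h : 2 * (R : ℤ) ≤ |(a : ℤ) - k|) :
    cutoff R k a = 0 := by
  have h' : 2 * (R : ℝ) ≤ |(a : ℝ) - k| := by exact_mod_cast h
  have hR' : (0 : ℝ) < R := by exact_mod_cast hR
  have : 2 ≤ |(a : ℝ) - k| / R := by rwa [le_div_iff₀ hR']
  rw [cutoff, min_eq_right (by linarith), max_eq_left (by linarith)]

theorem cutoff_congr {R k k' a a' : ℕ} (h : a + k' = a' + k) : cutoff R k a = cutoff R k' a' := by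
  have : (a : ℝ) - k = a' - k' := by
    have : (a : ℝ) + k' = a' + k := by exact_mod_cast h
    linarith
  rw [cutoff, cutoff, this]

theorem abs_cutoff_sub_le {R k a b : ℕ} (h : |(a : ℤ) - b| ≤ 1) :
    |cutoff R k a - cutoff R k b| ≤ 1 / R := by
  have h' : |(a : ℝ) - b| ≤ 1 := by exact_mod_cast h
  unfold cutoff
  refine (abs_max_sub_max_le_max _ _ _ _).trans ?_
  rw [sub_self, abs_zero, max_eq_right (abs_nonneg _)]
  refine (abs_min_sub_min_le_max _ _ _ _).trans ?_
  rw [sub_self, abs_zero, max_eq_right (abs_nonneg _)]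
  have h1 : 2 - |(a : ℝ) - k| / R - (2 - |(b : ℝ) - k| / R) =
      (|(b : ℝ) - k| - |(a : ℝ) - k|) / R := by ring
  rw [h1, abs_div, Nat.abs_cast]
  refine div_le_div_of_nonneg_right ?_ (Nat.cast_nonneg R)
  refine (abs_abs_sub_abs_le _ _).trans ?_
  rw [sub_sub_sub_cancel_right, abs_sub_comm]
  exact h'

/-- At most three terms are nonzero, since their labels are distinct and lie in {t-1, t, t+1}.
Integer labels also cover the rectangular matrices that shift one sample onto another. -/
theorem sum_abs_band_le {ι : Type*} [Fintype ι] (f : ι → ℝ) (g : ι → ℤ) (t : ℤ) {η : ℝ}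
    (hg : ∀ i j, f i ≠ 0 → f j ≠ 0 → g i = g j → i = j) (hf : ∀ i, |f i| ≤ η)
    (h0 : ∀ i, ¬ |g i - t| ≤ 1 → f i = 0) (hη : 0 ≤ η) : ∑ i, |f i| ≤ 3 * η := by
  classical
  rw [← Finset.sum_filter_add_sum_filter_not Finset.univ (fun i => f i ≠ 0),
    Finset.sum_eq_zero (s := Finset.univ.filter fun i => ¬ f i ≠ 0) (by simp), add_zero]
  have h1 : (Finset.univ.filter fun i => f i ≠ 0).card ≤ (Finset.Icc (t - 1) (t + 1)).card := by
    refine Finset.card_le_card_of_injOn g (fun i hi => ?_) (fun i hi j hj h => ?_)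
    · have hi' : f i ≠ 0 := by simpa using hi
      have := abs_le.1 (not_not.1 fun h => hi' (h0 i h))
      rw [Finset.mem_coe, Finset.mem_Icc]
      omega
    · exact hg i j (by simpa using hi) (by simpa using hj) h
  have h2 : (Finset.Icc (t - 1) (t + 1)).card = 3 := by
    rw [Int.card_Icc]; omega
  calc _ ≤ (Finset.univ.filter fun i => f i ≠ 0).card • η :=
        Finset.sum_le_card_nsmul _ _ _ fun i _ => hf i
    _ ≤ 3 * η := by
        rw [nsmul_eq_mul]
        refine mul_le_mul_of_nonneg_right ?_ hη
        rw [h2] at h1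
        exact_mod_cast h1

/-- Away from the changes, `A` inherits the lower bound of the unperturbed matrix `A₀`. -/
theorem nrm_mul_le_of_eq_mul {ι : Type*} [Fintype ι] {A A₀ : Matrix ι ι ℝ} (hA : A.IsHermitian)
    (ψ : ι → ℝ) {x d η : ℝ} (hη : 0 ≤ η) (h0 : ∀ i, 0 ≤ ψ i) (h1 : ∀ i, ψ i ≤ 1)
    (hd : ∀ u, d * nrm u ≤ nrm (A₀.mulVec u - x • u))
    (hAψ : ∀ a b, ψ b ≠ 0 → A₀ a b = A a b)
    (hsum : ∀ a, ∑ b, |A a b * (ψ b - ψ a)| ≤ η) (v : ι → ℝ) :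
    d * nrm (fun i => ψ i * v i) ≤ nrm (A.mulVec v - x • v) + η * nrm v := by
  refine (hd _).trans ?_
  -- On the support of ψ the columns of A₀ and A agree, so (A₀ - x)ψ = ψ(A - x) + [A, ψ], and the
  -- commutator has the entries A a b (ψ b - ψ a).
  have h2 : A₀.mulVec (fun i => ψ i * v i) - x • (fun i => ψ i * v i) =
      (fun i => ψ i * (A.mulVec v - x • v) i) +
        (Matrix.of fun a b => A a b * (ψ b - ψ a)).mulVec v := by
    funext a
    simp only [Matrix.mulVec, dotProduct, Pi.sub_apply, Pi.smul_apply, Pi.add_apply, smul_eq_mul,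
      Matrix.of_apply]
    rw [mul_sub, Finset.mul_sum, sub_add_eq_add_sub, ← Finset.sum_add_distrib]
    congr 1
    · refine Finset.sum_congr rfl fun b _ => ?_
      by_cases hb : ψ b = 0
      · rw [hb]; ring
      · rw [hAψ a b hb]; ring
    · ring
  rw [h2]
  refine (nrm_add_le _ _).trans (add_le_add ?_ ?_)
  · refine nrm_mono fun i => ?_
    rw [abs_mul, abs_of_nonneg (h0 i)]
    exact mul_le_of_le_one_left (abs_nonneg _) (h1 i)
  · refine nrm_mulVec_le_of_sum_le _ hη (fun a => hsum a) (fun b => ?_) v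
    refine le_trans (le_of_eq ?_) (hsum b)
    refine Finset.sum_congr rfl fun a _ => ?_
    have : A a b = A b a := by simpa using hA.apply b a
    rw [abs_mul, abs_mul, this, abs_sub_comm]

/-! ## Eigenvalues of a model with well separated changes -/

/-- The coefficients `s` deviate from `ρ` only near the points `k j`, and near `k j` they coincide
with `sub j`, which deviate from `ρ` only there. -/
structure LocalChanges {κ : Type*} (ρ S : ℝ) (R : ℕ) (k : κ → ℕ) (s : ℕ → ℝ)
    (sub : κ → ℕ → ℝ) : Prop where
  one_le : 1 ≤ R
  bound : ∀ t, |s t| ≤ S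
  bound_sub : ∀ j t, |sub j t| ≤ S
  near : ∀ j (t : ℕ), |(t : ℤ) - k j| ≤ 2 * R + 2 → s t = sub j t
  far_sub : ∀ j (t : ℕ), (R : ℤ) ≤ |(t : ℤ) - k j| → sub j t = ρ
  far : ∀ t : ℕ, (∀ j, (R : ℤ) ≤ |(t : ℤ) - k j|) → s t = ρ
  separated : ∀ i j, i ≠ j → 4 * (R : ℤ) ≤ |(k i : ℤ) - k j|

theorem cutAt_congr {s s' : ℕ → ℝ} {t : ℕ} (h : s t = s' t) (n : ℕ) :
    cutAt s n t = cutAt s' n t := by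
  rw [cutAt, cutAt, h]

/-- By symmetry the entry can be read from its column, so only s b and s (b+1) matter. This suits
vectors of which only the support is known. -/
theorem arMatrix_const_apply_eq {c ρ : ℝ} {s : ℕ → ℝ} {n : ℕ} (a b : Fin n)
    (h0 : s b = ρ) (h1 : s (b + 1) = ρ) :
    arMatrix c (fun _ => ρ) n a b = arMatrix c s n a b := by
  simp only [arMatrix, Matrix.of_apply]
  rw [arEntry_comm, arEntry_comm c _ (a : ℕ)]
  exact arEntry_congr c (cutAt_congr h0.symm n) (cutAt_congr h1.symm n) (by ring)

/-- Within the band the cut-off varies by at most 1/R. This is the source of all errors of the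
localization. -/
theorem abs_arEntry_mul_cutoff_sub_le {c S : ℝ} (hc : 0 ≤ c) {s : ℕ → ℝ} (hs : ∀ t, |s t| ≤ S)
    (R k a b : ℕ) :
    |arEntry c s a b * (cutoff R k b - cutoff R k a)| ≤ c * (1 + S) ^ 2 / R := by
  by_cases h : |(a : ℤ) - b| ≤ 1
  · rw [abs_mul, div_eq_mul_one_div]
    exact mul_le_mul (abs_arEntry_le hc hs a b)
      (abs_cutoff_sub_le (by rwa [abs_sub_comm])) (abs_nonneg _) (by positivity)
  · rw [arEntry_eq_zero c s h, zero_mul, abs_zero]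
    positivity

theorem sum_abs_arEntry_mul_cutoff_sub_le {c S : ℝ} (hc : 0 ≤ c) {s : ℕ → ℝ}
    (hs : ∀ t, |s t| ≤ S) (R k n a : ℕ) :
    ∑ b : Fin n, |arEntry c s a b * (cutoff R k b - cutoff R k a)| ≤
      3 * (c * (1 + S) ^ 2 / R) := by
  refine sum_abs_band_le _ (fun b : Fin n => (b : ℤ)) a
    (fun i j _ _ h => Fin.ext (by exact_mod_cast h))
    (fun b => abs_arEntry_mul_cutoff_sub_le hc hs R k a b) (fun b hb => ?_) (by positivity)
  rw [arEntry_eq_zero c s (by rwa [abs_sub_comm]), zero_mul]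

theorem sq_sum_eq_sum_sq {ι : Type*} [Fintype ι] {f : ι → ℝ}
    (hf : ∀ i j, i ≠ j → f i * f j = 0) : (∑ i, f i) ^ 2 = ∑ i, f i ^ 2 := by
  classical
  rw [sq, Finset.sum_mul_sum]
  refine Finset.sum_congr rfl fun i _ => ?_
  rw [Finset.sum_eq_single i, sq]
  · exact fun j _ hj => hf i j hj.symm
  · simp

/-- The cut-offs around the points `k j`, as a map from one copy of the state space to one copy
for each `j`. -/
def splitMatrix {κ : Type*} (R : ℕ) (k : κ → ℕ) (n : ℕ) : Matrix (Fin n × κ) (Fin n) ℝ :=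
  Matrix.of fun p b => if p.1 = b then cutoff R (k p.2) b else 0

section LocalChanges

variable {κ : Type*} [Fintype κ] {ρ S : ℝ} {R : ℕ} {k : κ → ℕ} {s : ℕ → ℝ} {sub : κ → ℕ → ℝ}

omit [Fintype κ] in
theorem splitMatrix_mulVec (n : ℕ) (v : Fin n → ℝ) (p : Fin n × κ) :
    (splitMatrix R k n).mulVec v p = cutoff R (k p.2) p.1 * v p.1 := by
  simp [splitMatrix, Matrix.mulVec, dotProduct]

theorem splitMatrix_transpose_mulVec (n : ℕ) (w : Fin n × κ → ℝ) (a : Fin n) :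
    (splitMatrix R k n).transpose.mulVec w a = ∑ j, cutoff R (k j) a * w (a, j) := by
  simp only [splitMatrix, Matrix.mulVec, dotProduct, Matrix.transpose_apply, Matrix.of_apply,
    Fintype.sum_prod_type]
  rw [Finset.sum_comm]
  simp

omit [Fintype κ] in
theorem LocalChanges.cutoff_mul_cutoff (H : LocalChanges ρ S R k s sub) {i j : κ} (hij : i ≠ j)
    (a : ℕ) : cutoff R (k i) a * cutoff R (k j) a = 0 := by
  have h := H.separated i j hij
  by_cases h1 : 2 * (R : ℤ) ≤ |(a : ℤ) - k i|
  · rw [cutoff_eq_zero H.one_le h1, zero_mul]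
  · rw [cutoff_eq_zero (k := k j) H.one_le, mul_zero]
    have h2 := abs_sub_abs_le_abs_sub ((k i : ℤ) - k j) ((k i : ℤ) - a)
    rw [sub_sub_sub_cancel_left, abs_sub_comm (k i : ℤ) a] at h2
    omega

theorem LocalChanges.sq_sum_cutoff_mul (H : LocalChanges ρ S R k s sub) (a : ℕ) (w : κ → ℝ) :
    (∑ j, cutoff R (k j) a * w j) ^ 2 = ∑ j, (cutoff R (k j) a * w j) ^ 2 := by
  refine sq_sum_eq_sum_sq fun i j hij => ?_
  calc _ = (cutoff R (k i) a * cutoff R (k j) a) * (w i * w j) := by ring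
    _ = 0 := by rw [H.cutoff_mul_cutoff hij, zero_mul]

theorem LocalChanges.sum_cutoff_le_one (H : LocalChanges ρ S R k s sub) (a : ℕ) :
    ∑ j, cutoff R (k j) a ≤ 1 := by
  by_cases h : ∃ j, cutoff R (k j) a ≠ 0
  · obtain ⟨j, hj⟩ := h
    rw [Finset.sum_eq_single j]
    · exact cutoff_le_one _ _ _
    · intro i _ hi
      exact (mul_eq_zero.1 (H.cutoff_mul_cutoff hi a)).resolve_right hj
    · simp
  · push Not at h
    simp [h]

theorem LocalChanges.sum_sq_cutoff_le_one (H : LocalChanges ρ S R k s sub) (a : ℕ) :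
    ∑ j, cutoff R (k j) a ^ 2 ≤ 1 :=
  (Finset.sum_le_sum fun j _ => by
    have h0 := cutoff_nonneg R (k j) a
    have h1 := cutoff_le_one R (k j) a
    nlinarith).trans (H.sum_cutoff_le_one a)

theorem LocalChanges.nrm_splitMatrix_mulVec_le (H : LocalChanges ρ S R k s sub) (n : ℕ)
    (v : Fin n → ℝ) : nrm ((splitMatrix R k n).mulVec v) ≤ nrm v := by
  refine nrm_le_of_sq_le (nrm_nonneg v) ?_
  rw [nrm_sq, Fintype.sum_prod_type]
  refine Finset.sum_le_sum fun a _ => ?_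
  simp only [splitMatrix_mulVec, mul_pow]
  rw [← Finset.sum_mul]
  exact mul_le_of_le_one_left (sq_nonneg _) (H.sum_sq_cutoff_le_one a)

/-- The cut-offs have disjoint supports, so gluing the copies together produces no cross terms. -/
theorem LocalChanges.nrm_splitMatrix_transpose_mulVec_le (H : LocalChanges ρ S R k s sub) (n : ℕ)
    (w : Fin n × κ → ℝ) : nrm ((splitMatrix R k n).transpose.mulVec w) ≤ nrm w := by
  refine nrm_le_of_sq_le (nrm_nonneg w) ?_
  rw [nrm_sq, Fintype.sum_prod_type]
  refine Finset.sum_le_sum fun a _ => ?_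
  rw [splitMatrix_transpose_mulVec, H.sq_sum_cutoff_mul]
  refine Finset.sum_le_sum fun j _ => ?_
  rw [mul_pow]
  exact mul_le_of_le_one_left (sq_nonneg _)
    (pow_le_one₀ (cutoff_nonneg _ _ _) (cutoff_le_one _ _ _))

variable [DecidableEq κ]

/-- The commutator of the cut-offs with the model. -/
theorem LocalChanges.commutator_eq (H : LocalChanges ρ S R k s sub) (c : ℝ) (n : ℕ) :
    Matrix.blockDiagonal (fun j => arMatrix c (sub j) n) * splitMatrix R k n -
      splitMatrix R k n * arMatrix c s n =
    Matrix.of fun (p : Fin n × κ) (b : Fin n) => arEntry c (cutAt s n) p.1 b *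
      (cutoff R (k p.2) b - cutoff R (k p.2) p.1) := by
  ext ⟨a, j⟩ b
  have h1 : (Matrix.blockDiagonal (fun j => arMatrix c (sub j) n) * splitMatrix R k n) (a, j) b =
      arMatrix c (sub j) n a b * cutoff R (k j) b := by
    simp [Matrix.mul_apply, Fintype.sum_prod_type, Matrix.blockDiagonal_apply, splitMatrix]
  have h2 : (splitMatrix R k n * arMatrix c s n) (a, j) b =
      cutoff R (k j) a * arMatrix c s n a b := by
    simp [Matrix.mul_apply, splitMatrix]
  rw [Matrix.sub_apply, h1, h2]
  simp only [arMatrix, Matrix.of_apply]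
  by_cases hab : |(a : ℤ) - b| ≤ 1
  -- Row a uses the coefficients at a and a + 1, so the radius 2R + 1 requires agreement up to 2R +
  -- 2. Beyond it, both cut-offs vanish on the whole band.
  · by_cases ha : |(a : ℤ) - k j| ≤ 2 * R + 1
    · have : arEntry c (cutAt s n) a b = arEntry c (cutAt (sub j) n) a b := by
        rw [abs_le] at ha
        refine arEntry_congr c (cutAt_congr (H.near j a ?_) n)
          (cutAt_congr (H.near j (a + 1) ?_) n) (by ring) <;> · rw [abs_le]; omega
      rw [this]; ring
    · rw [abs_le] at hab ha
      rw [cutoff_eq_zero (a := b) H.one_le (by rw [le_abs]; omega),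
        cutoff_eq_zero (a := a) H.one_le (by rw [le_abs]; omega)]
      ring
  · rw [arEntry_eq_zero _ _ hab, arEntry_eq_zero _ _ hab]; ring

/-- Schur's test: a row of the commutator has three nonzero entries, a column three for each change,
and the factor `card κ + 1` dominates both. The reverse estimate concerns minus the transpose of the
same commutator. -/
theorem LocalChanges.nrm_commutator_le (H : LocalChanges ρ S R k s sub) {c η : ℝ} (hc : 0 ≤ c)
    (hη : 3 * (Fintype.card κ + 1) * (c * (1 + S) ^ 2 / R) ≤ η) (n : ℕ) (v : Fin n → ℝ) :
    nrm ((Matrix.blockDiagonal (fun j => arMatrix c (sub j) n)).mulVec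
      ((splitMatrix R k n).mulVec v) -
      (splitMatrix R k n).mulVec ((arMatrix c s n).mulVec v)) ≤ η * nrm v ∧
    ∀ w, nrm ((arMatrix c s n).mulVec ((splitMatrix R k n).transpose.mulVec w) -
      (splitMatrix R k n).transpose.mulVec
        ((Matrix.blockDiagonal (fun j => arMatrix c (sub j) n)).mulVec w)) ≤ η * nrm w := by
  set D := Matrix.blockDiagonal (fun j => arMatrix c (sub j) n) with hD
  set Q := splitMatrix R k n
  have hcomm := H.commutator_eq c n
  rw [← hD] at hcomm
  set E : Matrix (Fin n × κ) (Fin n) ℝ := Matrix.of fun p b => arEntry c (cutAt s n) p.1 b *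
      (cutoff R (k p.2) b - cutoff R (k p.2) p.1) with hE
  set η₀ := c * (1 + S) ^ 2 / R with hη₀
  have h0 : 0 ≤ η₀ := by positivity
  have hs := abs_cutAt_le H.bound n
  have hrow : ∀ p, ∑ b, |E p b| ≤ η := fun p => by
    refine le_trans (sum_abs_arEntry_mul_cutoff_sub_le hc hs R (k p.2) n p.1) (le_trans ?_ hη)
    have : (0 : ℝ) ≤ 3 * Fintype.card κ * η₀ := by positivity
    rw [← hη₀]
    linarith
  have hcol : ∀ b, ∑ p, |E p b| ≤ η := fun b => by
    rw [Fintype.sum_prod_type, Finset.sum_comm]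
    refine le_trans (Finset.sum_le_card_nsmul _ _ (3 * η₀) fun j _ => ?_) (le_trans ?_ hη)
    · refine le_trans (le_of_eq ?_) (sum_abs_arEntry_mul_cutoff_sub_le hc hs R (k j) n b)
      refine Finset.sum_congr rfl fun a _ => ?_
      simp only [hE, Matrix.of_apply]
      rw [abs_mul, abs_mul, arEntry_comm, abs_sub_comm]
    · rw [nsmul_eq_mul, Finset.card_univ]
      linarith
  have hη' : 0 ≤ η := le_trans (by positivity) hη
  refine ⟨?_, fun w => ?_⟩
  · rw [Matrix.mulVec_mulVec, Matrix.mulVec_mulVec, ← Matrix.sub_mulVec, hcomm]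
    exact nrm_mulVec_le_of_sum_le _ hη' hrow hcol v
  · have hDt : D.transpose = D := by
      rw [hD, Matrix.blockDiagonal_transpose]
      congr 1
      funext j
      simpa [Matrix.IsHermitian] using arMatrix_isHermitian c (sub j) n
    have hBt : (arMatrix c s n).transpose = arMatrix c s n := by
      simpa [Matrix.IsHermitian] using arMatrix_isHermitian c s n
    have hcomm' : arMatrix c s n * Q.transpose - Q.transpose * D = (-E).transpose := by
      rw [← hcomm, neg_sub, Matrix.transpose_sub, Matrix.transpose_mul, Matrix.transpose_mul,
        hDt, hBt]
    rw [Matrix.mulVec_mulVec, Matrix.mulVec_mulVec, ← Matrix.sub_mulVec, hcomm']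
    refine nrm_mulVec_le_of_sum_le _ hη' (fun b => ?_) (fun p => ?_) w
    · simpa using hcol b
    · simpa using hrow p

omit [Fintype κ] in
theorem isHermitian_blockDiagonal_arMatrix (c : ℝ) (sub : κ → ℕ → ℝ) (n : ℕ) :
    (Matrix.blockDiagonal (fun j => arMatrix c (sub j) n)).IsHermitian := by
  rw [Matrix.IsHermitian, Matrix.blockDiagonal_conjTranspose]
  congr 1
  funext j
  exact arMatrix_isHermitian c (sub j) n

variable {c x d δ η : ℝ} {n : ℕ}

/-- Eigenvalues of the full model are near eigenvalues of the submodels. -/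
theorem LocalChanges.eigCount_le (H : LocalChanges ρ S R k s sub) (hc : 0 ≤ c)
    (hd0 : 0 < d) (hδ : 0 < δ) (hη : 3 * (Fintype.card κ + 1) * (c * (1 + S) ^ 2 / R) ≤ η)
    (hηδ : η ≤ δ / 4) (hδd : 1 / d * (δ + η) ≤ 1 / 4)
    (hd : ∀ u, d * nrm u ≤ nrm ((arMatrix c (fun _ => ρ) n).mulVec u - x • u)) :
    eigCount (arMatrix c s n) x δ ≤ ∑ j, eigCount (arMatrix c (sub j) n) x (2 * δ) := by
  rw [← eigCount_blockDiagonal]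
  have hη' : 0 ≤ η := le_trans (by positivity) hη
  have hs := abs_cutAt_le H.bound n
  refine eigCount_le_of_intertwining (arMatrix_isHermitian c s n)
    (isHermitian_blockDiagonal_arMatrix c sub n) (splitMatrix R k n) hδ (by positivity) hδd hηδ
    (H.nrm_splitMatrix_mulVec_le n) (fun v => (H.nrm_commutator_le hc hη n v).1) fun v => ?_
  -- ψ v is the part of v lost by the splitting. It lives off the plateaus, where the coefficients
  -- equal ρ, so the bulk bound controls it with constant 1/d.
  let ψ : Fin n → ℝ := fun a => 1 - ∑ j, cutoff R (k j) a
  have h1 := nrm_mul_le_of_eq_mul (arMatrix_isHermitian c s n) ψ (η := η) hη'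
    (fun a => by linarith [H.sum_cutoff_le_one a])
    (fun a => by
      have := Finset.sum_nonneg (s := Finset.univ) fun j _ => cutoff_nonneg R (k j) a
      linarith) hd (fun a b hb => by
      -- The strict inequality leaves room for the neighbour b + 1.
      have h : ∀ j, (R : ℤ) < |(b : ℤ) - k j| := fun j => by
        by_contra! hj
        have h1 := Finset.single_le_sum (f := fun j => cutoff R (k j) b)
          (fun j _ => cutoff_nonneg R (k j) b) (Finset.mem_univ j)
        simp only [cutoff_eq_one hj] at h1
        have h2 := H.sum_cutoff_le_one b
        exact hb (by simp only [ψ]; linarith)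
      refine arMatrix_const_apply_eq a b (H.far b fun j => (h j).le)
        (H.far (b + 1) fun j => ?_)
      have := h j
      rw [lt_abs] at this
      rw [le_abs]
      omega)
    (fun a => by
      have h2 : ∀ b : Fin n, |arMatrix c s n a b * (ψ b - ψ a)| ≤
          ∑ j, |arEntry c (cutAt s n) a b * (cutoff R (k j) b - cutoff R (k j) a)| := fun b => by
        refine le_trans (le_of_eq ?_) (Finset.abs_sum_le_sum_abs _ _)
        rw [← Finset.mul_sum, Finset.sum_sub_distrib, ← abs_neg]
        congr 1
        simp only [ψ, arMatrix, Matrix.of_apply]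
        ring
      refine (Finset.sum_le_sum fun b _ => h2 b).trans ?_
      rw [Finset.sum_comm]
      refine (Finset.sum_le_card_nsmul _ _ _ fun j _ =>
        sum_abs_arEntry_mul_cutoff_sub_le hc hs R (k j) n a).trans (le_trans ?_ hη)
      rw [nsmul_eq_mul, Finset.card_univ]
      have : 0 ≤ c * (1 + S) ^ 2 / R := by positivity
      linarith) v
  have h2 : nrm (fun a : Fin n => (∑ j, cutoff R (k j) a) * v a) ≤
      nrm ((splitMatrix R k n).mulVec v) := by
    refine nrm_le_of_sq_le (nrm_nonneg _) (le_of_eq ?_)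
    rw [nrm_sq, Fintype.sum_prod_type]
    refine Finset.sum_congr rfl fun a _ => ?_
    simp only [splitMatrix_mulVec]
    rw [Finset.sum_mul]
    exact H.sq_sum_cutoff_mul a fun _ => v a
  have h3 : v = (fun a : Fin n => (∑ j, cutoff R (k j) a) * v a) + fun a => ψ a * v a := by
    funext a
    simp [ψ, sub_mul]
  have h4 := nrm_add_le (fun a : Fin n => (∑ j, cutoff R (k j) a) * v a) (fun a => ψ a * v a)
  rw [← h3] at h4
  refine h4.trans (add_le_add h2 ?_)
  rw [one_div, ← div_eq_inv_mul, le_div_iff₀ hd0]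
  linarith

/-- Eigenvalues of the submodels are near eigenvalues of the full model. -/
theorem LocalChanges.sum_eigCount_le (H : LocalChanges ρ S R k s sub) (hc : 0 ≤ c)
    (hd0 : 0 < d) (hδ : 0 < δ) (hη : 3 * (Fintype.card κ + 1) * (c * (1 + S) ^ 2 / R) ≤ η)
    (hηδ : η ≤ δ / 4) (hδd : 1 / d * (δ + η) ≤ 1 / 4)
    (hd : ∀ u, d * nrm u ≤ nrm ((arMatrix c (fun _ => ρ) n).mulVec u - x • u)) :
    ∑ j, eigCount (arMatrix c (sub j) n) x δ ≤ eigCount (arMatrix c s n) x (2 * δ) := by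
  rw [← eigCount_blockDiagonal]
  have hη' : 0 ≤ η := le_trans (by positivity) hη
  refine eigCount_le_of_intertwining (isHermitian_blockDiagonal_arMatrix c sub n)
    (arMatrix_isHermitian c s n) (splitMatrix R k n).transpose hδ (by positivity) hδd hηδ
    -- The vector 0 is a dummy: the second half of the commutator bound does not involve it.
    (H.nrm_splitMatrix_transpose_mulVec_le n) (H.nrm_commutator_le hc hη n 0).2 fun w => ?_
  let ψ : Fin n × κ → ℝ := fun p => 1 - cutoff R (k p.2) p.1
  -- The comparison matrix is now one unperturbed copy for each change; the bulk bound holds copy by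
  -- copy.
  have hd' : ∀ u, d * nrm u ≤
      nrm ((Matrix.blockDiagonal fun _ : κ => arMatrix c (fun _ => ρ) n).mulVec u - x • u) := by
    intro u
    refine le_of_sq_le_sq ?_ (nrm_nonneg _)
    rw [mul_pow, nrm_sq, nrm_sq, Fintype.sum_prod_type_right, Fintype.sum_prod_type_right,
      Finset.mul_sum]
    refine Finset.sum_le_sum fun j _ => ?_
    have h := pow_le_pow_left₀ (mul_nonneg hd0.le (nrm_nonneg _)) (hd fun a => u (a, j)) 2
    rw [mul_pow, nrm_sq, nrm_sq] at h
    refine h.trans (le_of_eq (Finset.sum_congr rfl fun a _ => ?_))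
    simp [Matrix.mulVec, dotProduct, Fintype.sum_prod_type, Matrix.blockDiagonal_apply]
  have h1 := nrm_mul_le_of_eq_mul (isHermitian_blockDiagonal_arMatrix c sub n) ψ (η := η) hη'
    (fun p => by linarith [cutoff_le_one R (k p.2) p.1])
    (fun p => by linarith [cutoff_nonneg R (k p.2) p.1]) hd' (fun p q hq => by
      rw [Matrix.blockDiagonal_apply, Matrix.blockDiagonal_apply]
      by_cases hpq : p.2 = q.2
      · rw [if_pos hpq, if_pos hpq]
        have h : (R : ℤ) < |(q.1 : ℤ) - k p.2| := by
          rw [hpq]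
          by_contra! hj
          exact hq (by simp [ψ, cutoff_eq_one hj])
        refine arMatrix_const_apply_eq p.1 q.1 (H.far_sub _ _ h.le) (H.far_sub _ _ ?_)
        rw [lt_abs] at h
        rw [le_abs]
        omega
      · rw [if_neg hpq, if_neg hpq])
    (fun p => by
      rw [Fintype.sum_prod_type_right, Finset.sum_eq_single p.2]
      · refine le_trans (le_of_eq ?_) ((sum_abs_arEntry_mul_cutoff_sub_le hc
          (abs_cutAt_le (H.bound_sub p.2) n) R (k p.2) n p.1).trans (le_trans ?_ hη))
        · refine Finset.sum_congr rfl fun b _ => ?_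
          rw [Matrix.blockDiagonal_apply, if_pos rfl, ← abs_neg]
          congr 1
          simp only [ψ, arMatrix, Matrix.of_apply]
          ring
        · have h0 : 0 ≤ c * (1 + S) ^ 2 / R := by positivity
          have : 0 ≤ 3 * Fintype.card κ * (c * (1 + S) ^ 2 / R) := by positivity
          linarith
      · intro j _ hj
        refine Finset.sum_eq_zero fun b _ => ?_
        rw [Matrix.blockDiagonal_apply, if_neg (Ne.symm hj), zero_mul, abs_zero]
      · simp) w
  have h2 : nrm (fun p : Fin n × κ => cutoff R (k p.2) p.1 * w p) ≤
      nrm ((splitMatrix R k n).transpose.mulVec w) := by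
    refine nrm_le_of_sq_le (nrm_nonneg _) (le_of_eq ?_)
    rw [nrm_sq, Fintype.sum_prod_type]
    refine Finset.sum_congr rfl fun a _ => ?_
    rw [splitMatrix_transpose_mulVec]
    exact (H.sq_sum_cutoff_mul a fun j => w (a, j)).symm
  have h3 : w = (fun p : Fin n × κ => cutoff R (k p.2) p.1 * w p) + fun p => ψ p * w p := by
    funext p
    simp [ψ, sub_mul]
  have h4 := nrm_add_le (fun p : Fin n × κ => cutoff R (k p.2) p.1 * w p) (fun p => ψ p * w p)
  rw [← h3] at h4
  refine h4.trans (add_le_add h2 ?_)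
  rw [one_div, ← div_eq_inv_mul, le_div_iff₀ hd0]
  linarith

end LocalChanges

/-! ## Models with a single change -/

section single

variable {ρ S c x d δ η : ℝ} {R k k' n n' : ℕ} {s s' : ℕ → ℝ}

/-- A model with a single change has boundedly many eigenvalues near `x`. -/
theorem eigCount_le_of_far (hfar : ∀ t : ℕ, (R : ℤ) ≤ |(t : ℤ) - k| → s t = ρ)
    (hd : ∀ u, δ * nrm u ≤ nrm ((arMatrix c (fun _ => ρ) n).mulVec u - x • u)) :
    eigCount (arMatrix c s n) x δ ≤ 2 * R + 1 := by
  refine (eigCount_le_card (arMatrix_isHermitian c s n)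
    (Finset.univ.filter fun a : Fin n => |(a : ℤ) - k| ≤ R) fun v hv => ?_).trans ?_
  · refine (hd v).trans (le_of_eq ?_)
    -- A vector that vanishes within distance R of k does not feel the change, and only 2R + 1
    -- coordinates are removed.
    have h : (arMatrix c (fun _ => ρ) n).mulVec v = (arMatrix c s n).mulVec v := by
      funext a
      rw [Matrix.mulVec, Matrix.mulVec, dotProduct, dotProduct]
      refine Finset.sum_congr rfl fun b _ => ?_
      by_cases hb : |(b : ℤ) - k| ≤ R
      · rw [hv b (by simpa using hb), mul_zero, mul_zero]
      · rw [arMatrix_const_apply_eq a b (hfar b (not_le.1 hb).le) (hfar (b + 1) ?_)]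
        rw [not_le, lt_abs] at hb
        rw [le_abs]
        omega
    rw [h]
  · refine (Finset.card_le_card_of_injOn (fun a : Fin n => (a : ℤ))
      (t := Finset.Icc ((k : ℤ) - R) (k + R)) (fun a ha => ?_) (fun a _ b _ h => ?_)).trans ?_
    · have ha' : |(a : ℤ) - k| ≤ R := by simpa using ha
      rw [abs_le] at ha'
      simp only [Finset.coe_Icc, Set.mem_Icc]
      omega
    · simp only [Nat.cast_inj] at h
      exact Fin.ext h
    · rw [Int.card_Icc]; omega

/-- The eigenvalues near `x` of a model with a single change far away from both ends do not depend
on the position of the change. -/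
theorem eigCount_le_of_shift (hR : 1 ≤ R) (hc : 0 ≤ c) (hd0 : 0 < d) (hδ : 0 < δ)
    (hη : 3 * (c * (1 + S) ^ 2 / R) ≤ η) (hηδ : η ≤ δ / 4) (hδd : 1 / d * (δ + η) ≤ 1 / 4)
    (hs : ∀ t, |s t| ≤ S) (hs' : ∀ t, |s' t| ≤ S)
    (hfar : ∀ t : ℕ, (R : ℤ) ≤ |(t : ℤ) - k| → s t = ρ)
    (hshift : ∀ t t' : ℕ, t + k' = t' + k → s t = s' t')
    (hk : 2 * R + 2 ≤ k) (hn : k + 2 * R + 2 < n) (hk' : 2 * R + 2 ≤ k')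
    (hn' : k' + 2 * R + 2 < n')
    (hd : ∀ u, d * nrm u ≤ nrm ((arMatrix c (fun _ => ρ) n).mulVec u - x • u)) :
    eigCount (arMatrix c s n) x δ ≤ eigCount (arMatrix c s' n') x (2 * δ) := by
  have h00 : 0 ≤ c * (1 + S) ^ 2 / R := by positivity
  have hη' : 0 ≤ η := le_trans (by positivity) hη
  -- J cuts off around k and then translates k to k'. The margins 2R + 2 keep the translated support
  -- inside both samples, clear of the boundary entries.
  set J : Matrix (Fin n') (Fin n) ℝ := Matrix.of fun a' a =>
    if (a : ℕ) + k' = a' + k then cutoff R k a else 0 with hJ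
  have hJapp : ∀ a' a, J a' a = if (a : ℕ) + k' = a' + k then cutoff R k a else 0 :=
    fun _ _ => rfl
  have hcut : ∀ {k a : ℕ}, cutoff R k a ≠ 0 → |(a : ℤ) - k| < 2 * R := fun h =>
    lt_of_not_ge fun h' => h (cutoff_eq_zero hR h')
  have hto : ∀ b : Fin n, cutoff R k b ≠ 0 → ∃ e : Fin n', (b : ℕ) + k' = e + k := fun b hb => by
    have := abs_lt.1 (hcut hb)
    exact ⟨⟨b + k' - k, by omega⟩, by simp only []; omega⟩
  have hfrom : ∀ a' : Fin n', cutoff R k' a' ≠ 0 → ∃ a : Fin n, (a : ℕ) + k' = a' + k :=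
    fun a' ha' => by
      have := abs_lt.1 (hcut ha')
      exact ⟨⟨a' + k - k', by omega⟩, by simp only []; omega⟩
  have hnrm : ∀ v, nrm (J.mulVec v) = nrm fun a : Fin n => cutoff R k a * v a := fun v => by
    have : nrm (J.mulVec v) ^ 2 = nrm (fun a : Fin n => cutoff R k a * v a) ^ 2 := by
      rw [nrm_sq, nrm_sq]
      have h1 : ∀ a', J.mulVec v a' ^ 2 = ∑ a, (J a' a * v a) ^ 2 := fun a' => by
        refine sq_sum_eq_sum_sq (f := fun a => J a' a * v a) fun a b hab => ?_
        rw [hJapp, hJapp]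
        have : (a : ℕ) ≠ b := fun h => hab (Fin.ext h)
        split_ifs <;> first | omega | simp
      simp_rw [h1]
      rw [Finset.sum_comm]
      refine Finset.sum_congr rfl fun a _ => ?_
      by_cases ha : cutoff R k a = 0
      · simp [hJapp, ha]
      · obtain ⟨e, he⟩ := hto a ha
        rw [Finset.sum_eq_single e, hJapp, if_pos he]
        · intro b _ hb
          have : (b : ℕ) ≠ e := fun h => hb (Fin.ext h)
          rw [hJapp, if_neg (by omega)]
          simp
        · simp
    exact (pow_left_inj₀ (nrm_nonneg _) (nrm_nonneg _) two_ne_zero).1 this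
  refine eigCount_le_of_intertwining (arMatrix_isHermitian c s n)
    (arMatrix_isHermitian c s' n') J hδ (by positivity) hδd hηδ (fun v => ?_) (fun v => ?_)
    fun v => ?_
  · rw [hnrm]
    refine nrm_mono fun a => ?_
    rw [abs_mul, abs_of_nonneg (cutoff_nonneg _ _ _)]
    exact mul_le_of_le_one_left (abs_nonneg _) (cutoff_le_one _ _ _)
  · have hl : ∀ (a' : Fin n') (b : Fin n), (arMatrix c s' n' * J) a' b =
        arEntry c (cutAt s' n') a' (b + k' - k) * cutoff R k b := fun a' b => by
      rw [Matrix.mul_apply]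
      by_cases hb : cutoff R k b = 0
      · simp [hJapp, hb]
      · obtain ⟨e, he⟩ := hto b hb
        rw [Finset.sum_eq_single e, hJapp, if_pos he, arMatrix, Matrix.of_apply,
          show (b : ℕ) + k' - k = e by omega]
        · intro f _ hf
          have : (f : ℕ) ≠ e := fun h => hf (Fin.ext h)
          rw [hJapp, if_neg (by omega), mul_zero]
        · simp
    have hr : ∀ (a' : Fin n') (b : Fin n), (J * arMatrix c s n) a' b =
        arEntry c (cutAt s' n') a' (b + k' - k) * cutoff R k' a' := fun a' b => by
      rw [Matrix.mul_apply]
      by_cases ha' : cutoff R k' a' = 0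
      · rw [ha', mul_zero]
        refine Finset.sum_eq_zero fun a _ => ?_
        rw [hJapp]
        split_ifs with h
        · rw [cutoff_congr h, ha', zero_mul]
        · rw [zero_mul]
      · obtain ⟨a, ha⟩ := hfrom a' ha'
        have h2 := abs_lt.1 (hcut ha')
        rw [Finset.sum_eq_single a, hJapp, if_pos ha, cutoff_congr ha, mul_comm]
        · congr 1
          rw [arMatrix, Matrix.of_apply]
          by_cases hb : k ≤ b + k'
          · refine arEntry_congr c ?_ ?_ (by omega)
            · rw [cutAt, cutAt, if_pos (by omega), if_pos (by omega), hshift a a' ha]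
            · rw [cutAt, cutAt, if_pos (by omega), if_pos (by omega),
                hshift (a + 1) (a' + 1) (by omega)]
          · rw [arEntry_eq_zero, arEntry_eq_zero] <;> · rw [abs_le]; omega
        · intro f _ hf
          have : (f : ℕ) ≠ a := fun h => hf (Fin.ext h)
          rw [hJapp, if_neg (by omega), zero_mul]
        · simp
    rw [Matrix.mulVec_mulVec, Matrix.mulVec_mulVec, ← Matrix.sub_mulVec]
    have hE : ∀ a' b, (arMatrix c s' n' * J - J * arMatrix c s n) a' b =
        arEntry c (cutAt s' n') a' (b + k' - k) * (cutoff R k b - cutoff R k' a') := fun a' b => by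
      rw [Matrix.sub_apply, hl, hr, mul_sub]
    have hE1 : ∀ a' b, |(arMatrix c s' n' * J - J * arMatrix c s n) a' b| ≤
        c * (1 + S) ^ 2 / R := fun a' b => by
      rw [hE]
      by_cases hb : k ≤ b + k'
      · rw [cutoff_congr (k' := k') (a' := b + k' - k) (by omega)]
        exact abs_arEntry_mul_cutoff_sub_le hc (abs_cutAt_le hs' n') R k' a' _
      -- Here b + k' - k is truncated to 0. Such b lies outside the cut-off around k, and a row a'
      -- in the cut-off around k' is too far from column 0 to meet the band.
      · have hb0 : cutoff R k b = 0 := by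
          by_contra h
          have := abs_lt.1 (hcut h)
          omega
        by_cases ha' : cutoff R k' a' = 0
        · rw [hb0, ha', sub_zero, mul_zero, abs_zero]
          exact h00
        · have := abs_lt.1 (hcut ha')
          rw [arEntry_eq_zero, zero_mul, abs_zero]
          · exact h00
          · rw [abs_le]; omega
    have hE0 : ∀ (a' : Fin n') (b : Fin n), ¬ |(b : ℤ) + k' - k - a'| ≤ 1 →
        (arMatrix c s' n' * J - J * arMatrix c s n) a' b = 0 := fun a' b hab => by
      rw [hE]
      rw [abs_le] at hab
      by_cases hb : k ≤ b + k'
      · rw [arEntry_eq_zero, zero_mul]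
        rw [abs_le]; omega
      · have hb0 : cutoff R k b = 0 := by
          by_contra h
          have := abs_lt.1 (hcut h)
          omega
        by_cases ha' : cutoff R k' a' = 0
        · rw [hb0, ha', sub_zero, mul_zero]
        · have := abs_lt.1 (hcut ha')
          rw [arEntry_eq_zero, zero_mul]
          rw [abs_le]; omega
    refine nrm_mulVec_le_of_sum_le _ hη' (fun a' => le_trans ?_ hη) (fun b => le_trans ?_ hη) v
    · refine sum_abs_band_le _ (fun b : Fin n => (b : ℤ) + k' - k) a' (fun i j _ _ h => ?_)
        (hE1 a') (hE0 a') h00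
      exact Fin.ext (by omega)
    · refine sum_abs_band_le _ (fun a' : Fin n' => (a' : ℤ)) (b + k' - k) (fun i j _ _ h => ?_)
        (fun a' => hE1 a' b) (fun a' h => hE0 a' b (by rwa [abs_sub_comm])) h00
      exact Fin.ext (by omega)
  · have h1 := nrm_mul_le_of_eq_mul (arMatrix_isHermitian c s n)
      (fun a => 1 - cutoff R k a) (η := η) hη' (fun a => by linarith [cutoff_le_one R k a])
      (fun a => by linarith [cutoff_nonneg R k a]) hd (fun a b hb => by
        have h : (R : ℤ) < |(b : ℤ) - k| := by
          by_contra! hj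
          exact hb (by simp [cutoff_eq_one hj])
        refine arMatrix_const_apply_eq a b (hfar _ h.le) (hfar _ ?_)
        rw [lt_abs] at h
        rw [le_abs]
        omega)
      (fun a => by
        refine le_trans (le_of_eq ?_) ((sum_abs_arEntry_mul_cutoff_sub_le hc
          (abs_cutAt_le hs n) R k n a).trans hη)
        refine Finset.sum_congr rfl fun b _ => ?_
        rw [← abs_neg]
        congr 1
        simp only [arMatrix, Matrix.of_apply]
        ring) v
    have h3 : v = (fun a : Fin n => cutoff R k a * v a) + fun a : Fin n =>
        (1 - cutoff R k a) * v a := by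
      funext a
      simp [sub_mul]
    have h4 := nrm_add_le (fun a : Fin n => cutoff R k a * v a)
      (fun a : Fin n => (1 - cutoff R k a) * v a)
    rw [← h3] at h4
    rw [hnrm]
    refine h4.trans (add_le_add le_rfl ?_)
    rw [one_div, ← div_eq_inv_mul, le_div_iff₀ hd0]
    linarith

end single

/-! ## Riemann sums -/

theorem tendsto_riemann_sum {g : ℝ → ℝ} (hg : Continuous g) :
    Tendsto (fun n : ℕ => (n : ℝ)⁻¹ * ∑ k ∈ Finset.range n, g ((k + 1 : ℕ) / n)) atTop
      (𝓝 (∫ u in (0 : ℝ)..1, g u)) := by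
  rw [Metric.tendsto_atTop]
  intro ε hε
  obtain ⟨δ, hδ, hgδ⟩ := Metric.uniformContinuousOn_iff.1
    (isCompact_Icc.uniformContinuousOn_of_continuous hg.continuousOn : UniformContinuousOn g
      (Set.Icc (0 : ℝ) 1)) (ε / 2) (by positivity)
  obtain ⟨N, hN⟩ := exists_nat_gt δ⁻¹
  refine ⟨N + 1, fun n hn => ?_⟩
  have hn0 : (0 : ℝ) < n := by exact_mod_cast (by omega : 0 < n)
  have hnδ : (n : ℝ)⁻¹ < δ := by
    rw [inv_lt_comm₀ hn0 hδ]
    refine hN.trans ?_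
    exact_mod_cast (by omega : N < n)
  have hsum : ∫ u in (0 : ℝ)..1, g u =
      ∑ k ∈ Finset.range n, ∫ u in ((k : ℕ) / n : ℝ)..((k + 1 : ℕ) / n : ℝ), g u := by
    rw [intervalIntegral.sum_integral_adjacent_intervals (a := fun k : ℕ => (k / n : ℝ))
      (fun k _ => hg.intervalIntegrable _ _)]
    simp [hn0.ne']
  rw [dist_eq_norm, hsum, Finset.mul_sum, ← Finset.sum_sub_distrib]
  have hk : ∀ k ∈ Finset.range n, ‖(n : ℝ)⁻¹ * g ((k + 1 : ℕ) / n) -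
      ∫ u in ((k : ℕ) / n : ℝ)..((k + 1 : ℕ) / n : ℝ), g u‖ ≤ ε / 2 * (n : ℝ)⁻¹ := by
    intro k hk
    have hkn : ((k + 1 : ℕ) : ℝ) ≤ n := by exact_mod_cast Finset.mem_range.1 hk
    have hlen : ((k + 1 : ℕ) / n : ℝ) - (k : ℕ) / n = (n : ℝ)⁻¹ := by
      push_cast; field_simp; ring
    have hle : ((k : ℕ) / n : ℝ) ≤ (k + 1 : ℕ) / n := by
      have : (0 : ℝ) < (n : ℝ)⁻¹ := by positivity
      linarith
    have hc : (n : ℝ)⁻¹ * g ((k + 1 : ℕ) / n) =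
        ∫ _ in ((k : ℕ) / n : ℝ)..((k + 1 : ℕ) / n : ℝ), g ((k + 1 : ℕ) / n) := by
      rw [intervalIntegral.integral_const, hlen, smul_eq_mul]
    rw [hc, ← intervalIntegral.integral_sub (by simp) (hg.intervalIntegrable _ _)]
    have hb := intervalIntegral.norm_integral_le_of_norm_le_const (C := ε / 2)
      (f := fun u => g ((k + 1 : ℕ) / n) - g u) (a := ((k : ℕ) / n : ℝ))
      (b := ((k + 1 : ℕ) / n : ℝ)) fun u hu => ?_
    · rwa [hlen, abs_of_pos (by positivity)] at hb
    · rw [Set.uIoc_of_le hle] at hu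
      have h0 : (0 : ℝ) ≤ (k : ℕ) / n := by positivity
      have h1 : ((k + 1 : ℕ) / n : ℝ) ≤ 1 := div_le_one_of_le₀ hkn hn0.le
      rw [← dist_eq_norm]
      refine (hgδ _ ⟨by linarith, h1⟩ u ⟨by linarith [hu.1], by linarith [hu.2]⟩ ?_).le
      rw [Real.dist_eq, abs_of_nonneg (by linarith [hu.2])]
      linarith [hu.1]
  refine (norm_sum_le_of_le _ hk).trans_lt ?_
  rw [Finset.sum_const, Finset.card_range, nsmul_eq_mul]
  have : (n : ℝ) * (ε / 2 * (n : ℝ)⁻¹) = ε / 2 := by field_simp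
  linarith

/-- The nodes are those of the Toeplitz eigenvalues. The sum is (1 + 1/n) times the right-endpoint
sum with n + 1 nodes, minus the term g 1 / n. -/
theorem tendsto_interior_riemann_sum {g : ℝ → ℝ} (hg : Continuous g) :
    Tendsto (fun n : ℕ => (n : ℝ)⁻¹ * ∑ k ∈ Finset.range n, g ((k + 1 : ℕ) / (n + 1 : ℕ))) atTop
      (𝓝 (∫ u in (0 : ℝ)..1, g u)) := by
  have h1 := (tendsto_riemann_sum hg).comp (tendsto_add_atTop_nat 1)
  have h2 : Tendsto (fun n : ℕ => (n : ℝ)⁻¹) atTop (𝓝 0) := tendsto_inv_atTop_nhds_zero_nat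
  have h3 := ((h2.const_add 1).mul h1).sub (h2.mul_const (g 1))
  simp only [add_zero, one_mul, zero_mul, sub_zero] at h3
  refine h3.congr' ?_
  filter_upwards [eventually_gt_atTop 0] with n hn
  have hn0 : (n : ℝ) ≠ 0 := by exact_mod_cast hn.ne'
  have hn1 : ((n : ℝ) + 1) ≠ 0 := by positivity
  simp only [Function.comp_apply]
  rw [Finset.sum_range_succ, div_self (by exact_mod_cast hn1)]
  push_cast
  field_simp
  ring

/-! ## Traces of powers -/

section trace

variable {ι : Type*} [Fintype ι] [DecidableEq ι]

theorem sum_eigenvalues_pow {A : Matrix ι ι ℝ} (hA : A.IsHermitian) (p : ℕ) :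
    ∑ i, hA.eigenvalues i ^ p = (A ^ p).trace := by
  conv_rhs => rw [hA.spectral_theorem, ← map_pow, Unitary.conjStarAlgAut_apply]
  rw [Matrix.trace_mul_cycle, Unitary.coe_star_mul_self, one_mul,
    Matrix.diagonal_pow, Matrix.trace_diagonal]
  rfl

omit [DecidableEq ι] in
theorem sum_abs_mul_le (X Y : Matrix ι ι ℝ) {M : ℝ} (hY : ∀ a, ∑ b, |Y a b| ≤ M) :
    ∑ a, ∑ b, |(X * Y) a b| ≤ (∑ a, ∑ b, |X a b|) * M := by
  rw [Finset.sum_mul]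
  refine Finset.sum_le_sum fun a _ => ?_
  calc ∑ b, |(X * Y) a b| ≤ ∑ b, ∑ e, |X a e| * |Y e b| := by
        refine Finset.sum_le_sum fun b _ => ?_
        rw [Matrix.mul_apply]
        refine (Finset.abs_sum_le_sum_abs _ _).trans (le_of_eq ?_)
        simp_rw [abs_mul]
    _ = ∑ e, |X a e| * ∑ b, |Y e b| := by
        rw [Finset.sum_comm]; simp_rw [Finset.mul_sum]
    _ ≤ ∑ e, |X a e| * M :=
        Finset.sum_le_sum fun e _ => mul_le_mul_of_nonneg_left (hY e) (abs_nonneg _)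
    _ = _ := by rw [Finset.sum_mul]

/-- Telescoping, A^(p+1) - B^(p+1) = (A^p - B^p) A + B^p (A - B). The entrywise ℓ¹ norm grows at
most by the factor M under multiplication from the right, and, B being symmetric, also by B from the
left. -/
theorem sum_abs_pow_sub_pow_le (A B : Matrix ι ι ℝ) {M : ℝ} (hM : 0 ≤ M)
    (hA : ∀ a, ∑ b, |A a b| ≤ M) (hB : ∀ a, ∑ b, |B a b| ≤ M) (hBs : B.IsHermitian)
    (p : ℕ) :
    ∑ a, ∑ b, |(A ^ p - B ^ p) a b| ≤ p * M ^ (p - 1) * ∑ a, ∑ b, |(A - B) a b| := by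
  have hl : ∀ (q : ℕ) (X : Matrix ι ι ℝ),
      ∑ a, ∑ b, |(B ^ q * X) a b| ≤ M ^ q * ∑ a, ∑ b, |X a b| := fun q => by
    induction q with
    | zero => simp
    | succ q ih =>
      intro X
      rw [pow_succ, mul_assoc]
      refine (ih _).trans ?_
      rw [pow_succ, mul_assoc]
      refine mul_le_mul_of_nonneg_left ?_ (by positivity)
      have hT : B.transpose = B := by simpa [Matrix.IsHermitian] using hBs
      have h := sum_abs_mul_le X.transpose B hB
      rw [Finset.sum_comm, mul_comm]
      rw [Finset.sum_comm (f := fun a b => |X a b|)]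
      refine le_trans (le_of_eq ?_) h
      refine Finset.sum_congr rfl fun a _ => Finset.sum_congr rfl fun b _ => ?_
      rw [← Matrix.transpose_apply (B * X), Matrix.transpose_mul, hT]
  induction p with
  | zero => simp
  | succ p ih =>
    have h1 : A ^ (p + 1) - B ^ (p + 1) = (A ^ p - B ^ p) * A + B ^ p * (A - B) := by
      rw [pow_succ, pow_succ]; noncomm_ring
    have hring : ∀ V : ℝ, p * M ^ (p - 1) * V * M + M ^ p * V =
        (p + 1 : ℕ) * M ^ (p + 1 - 1) * V := fun V => by
      rcases p with _ | p
      · simp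
      · rw [Nat.add_sub_cancel, Nat.add_sub_cancel]
        push_cast
        ring
    calc ∑ a, ∑ b, |(A ^ (p + 1) - B ^ (p + 1)) a b|
        ≤ ∑ a, ∑ b, (|((A ^ p - B ^ p) * A) a b| + |(B ^ p * (A - B)) a b|) := by
          rw [h1]
          exact Finset.sum_le_sum fun a _ => Finset.sum_le_sum fun b _ => abs_add_le _ _
      _ ≤ p * M ^ (p - 1) * (∑ a, ∑ b, |(A - B) a b|) * M +
          M ^ p * ∑ a, ∑ b, |(A - B) a b| := by
          simp_rw [Finset.sum_add_distrib]
          refine add_le_add ((sum_abs_mul_le _ _ hA).trans ?_) (hl p _)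
          exact mul_le_mul_of_nonneg_right ih hM
      _ = _ := hring _

omit [DecidableEq ι] in
theorem abs_trace_le (X : Matrix ι ι ℝ) : |X.trace| ≤ ∑ a, ∑ b, |X a b| := by
  refine (Finset.abs_sum_le_sum_abs _ _).trans (Finset.sum_le_sum fun a _ => ?_)
  exact Finset.single_le_sum (f := fun b => |X a b|) (fun _ _ => abs_nonneg _) (Finset.mem_univ a)

theorem abs_eigenvalues_le {A : Matrix ι ι ℝ} (hA : A.IsHermitian) {M : ℝ} (hM : 0 ≤ M)
    (h : ∀ a, ∑ b, |A a b| ≤ M) (i : ι) : |hA.eigenvalues i| ≤ M := by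
  have h1 := nrm_mulVec_le_of_sum_le A hM h (fun b => by
    refine le_trans (le_of_eq (Finset.sum_congr rfl fun a _ => ?_)) (h b)
    rw [show A a b = A b a by simpa using hA.apply b a]) (hA.eigenvectorBasis i)
  rw [hA.mulVec_eigenvectorBasis] at h1
  have h2 : nrm (⇑(hA.eigenvectorBasis i)) = 1 := hA.eigenvectorBasis.orthonormal.1 i
  rw [nrm_smul, h2] at h1
  simpa using h1

/-- Spectral sums of polynomials are stable under perturbations that are small in trace norm. -/
theorem exists_abs_sum_eval_sub_le (q : Polynomial ℝ) {M V : ℝ} (hM : 0 ≤ M) :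
    ∃ C : ℝ, ∀ (n : ℕ) (A B : Matrix (Fin n) (Fin n) ℝ) (hA : A.IsHermitian)
      (hB : B.IsHermitian), (∀ a, ∑ b, |A a b| ≤ M) → (∀ a, ∑ b, |B a b| ≤ M) →
      (∑ a, ∑ b, |(A - B) a b| ≤ V) →
      |∑ i, q.eval (hA.eigenvalues i) - ∑ i, q.eval (hB.eigenvalues i)| ≤ C := by
  induction q using Polynomial.induction_on' with
  | add q₁ q₂ h₁ h₂ =>
    obtain ⟨C₁, h₁⟩ := h₁
    obtain ⟨C₂, h₂⟩ := h₂
    refine ⟨C₁ + C₂, fun n A B hA hB hAM hBM hV => ?_⟩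
    simp only [Polynomial.eval_add, Finset.sum_add_distrib]
    rw [add_sub_add_comm]
    exact (abs_add_le _ _).trans
      (add_le_add (h₁ n A B hA hB hAM hBM hV) (h₂ n A B hA hB hAM hBM hV))
  | monomial p a =>
    -- The bound does not depend on n, so it disappears after division by n.
    refine ⟨|a| * (p * M ^ (p - 1) * V), fun n A B hA hB hAM hBM hV => ?_⟩
    simp only [Polynomial.eval_monomial]
    rw [← Finset.mul_sum, ← Finset.mul_sum, ← mul_sub, abs_mul, sum_eigenvalues_pow,
      sum_eigenvalues_pow, ← Matrix.trace_sub]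
    refine mul_le_mul_of_nonneg_left ?_ (abs_nonneg a)
    refine (abs_trace_le _).trans ((sum_abs_pow_sub_pow_le A B hM hAM hBM hB p).trans ?_)
    exact mul_le_mul_of_nonneg_left hV (by positivity)

end trace

/-! ## The asymptotic spectral distribution -/

/-- The symbol of the precision operator of a stationary autoregression. -/
def arSymbol (c ρ u : ℝ) : ℝ := c * (1 + ρ ^ 2 - 2 * ρ * Real.cos (Real.pi * u))

theorem continuous_arSymbol (c ρ : ℝ) : Continuous (arSymbol c ρ) := by
  unfold arSymbol; fun_prop

theorem arSymbol_mem_Icc {c : ℝ} (hc : 0 ≤ c) (ρ u : ℝ) :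
    arSymbol c ρ u ∈ Set.Icc (c * (1 - |ρ|) ^ 2) (c * (1 + |ρ|) ^ 2) := by
  have h1 : |ρ * Real.cos (Real.pi * u)| ≤ |ρ| := by
    rw [abs_mul]; exact mul_le_of_le_one_right (abs_nonneg _) (Real.abs_cos_le_one _)
  rw [abs_le] at h1
  have h2 := sq_abs ρ
  constructor <;> · refine mul_le_mul_of_nonneg_left ?_ hc; nlinarith

theorem Icc_subset_arSymbol_image {c ρ : ℝ} :
    Set.Icc (c * (1 - |ρ|) ^ 2) (c * (1 + |ρ|) ^ 2) ⊆ arSymbol c ρ '' Set.Icc 0 1 := by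
  have h0 : arSymbol c ρ 0 = c * (1 - ρ) ^ 2 := by
    simp only [arSymbol, mul_zero, Real.cos_zero]; ring
  have h1 : arSymbol c ρ 1 = c * (1 + ρ) ^ 2 := by
    simp only [arSymbol, mul_one, Real.cos_pi]; ring
  -- The sign of ρ decides which end of the frequency interval gives which end of the bulk.
  rcases abs_cases ρ with ⟨h, -⟩ | ⟨h, -⟩
  · rw [h, ← h0, ← h1]
    exact intermediate_value_Icc zero_le_one (continuous_arSymbol c ρ).continuousOn
  · rw [h, sub_neg_eq_add, ← sub_eq_add_neg, ← h0, ← h1]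
    exact intermediate_value_Icc' zero_le_one (continuous_arSymbol c ρ).continuousOn

/-- The law of the symbol at a uniformly distributed frequency. -/
def arLaw (c ρ : ℝ) : ProbabilityMeasure ℝ :=
  ⟨(volume.restrict (Set.Icc (0 : ℝ) 1)).map (arSymbol c ρ), by
    have : IsProbabilityMeasure (volume.restrict (Set.Icc (0 : ℝ) 1)) :=
      ⟨by simp⟩
    exact Measure.isProbabilityMeasure_map (continuous_arSymbol c ρ).measurable.aemeasurable⟩

theorem coe_arLaw (c ρ : ℝ) : (arLaw c ρ : Measure ℝ) =
    (volume.restrict (Set.Icc (0 : ℝ) 1)).map (arSymbol c ρ) := rfl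

theorem support_arLaw {c : ℝ} (hc : 0 ≤ c) (ρ : ℝ) :
    (arLaw c ρ : Measure ℝ).support =
      Set.Icc (c * (1 - |ρ|) ^ 2) (c * (1 + |ρ|) ^ 2) := by
  have hm := (continuous_arSymbol c ρ).measurable
  apply Set.Subset.antisymm
  · refine Measure.support_subset_of_isClosed isClosed_Icc ?_
    rw [coe_arLaw, mem_ae_map_iff hm.aemeasurable measurableSet_Icc]
    exact Filter.univ_mem' fun u => arSymbol_mem_Icc hc ρ u
  · intro y hy
    obtain ⟨u, hu, rfl⟩ := Icc_subset_arSymbol_image hy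
    rw [Measure.mem_support_iff_forall]
    intro U hU
    obtain ⟨V, hVU, hV, hyV⟩ := mem_nhds_iff.1 hU
    refine lt_of_lt_of_le ?_ (measure_mono hVU)
    rw [coe_arLaw, Measure.map_apply hm hV.measurableSet,
      Measure.restrict_apply (hm hV.measurableSet)]
    have hopen : IsOpen (arSymbol c ρ ⁻¹' V) := hV.preimage (continuous_arSymbol c ρ)
    -- The frequency u may be an endpoint, so an open set around it is intersected with the open
    -- interval to obtain positive measure.
    have hcl : u ∈ closure (Set.Ioo (0 : ℝ) 1) := by
      rwa [closure_Ioo zero_ne_one]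
    obtain ⟨w, hw⟩ := mem_closure_iff.1 hcl _ hopen hyV
    refine lt_of_lt_of_le ((hopen.inter isOpen_Ioo).measure_pos volume ⟨w, hw⟩)
      (measure_mono (Set.inter_subset_inter_right _ Set.Ioo_subset_Icc_self))

/-- The tridiagonal Toeplitz matrix of the stationary autoregression. -/
def toeplitzMatrix (c ρ : ℝ) (n : ℕ) : Matrix (Fin n) (Fin n) ℝ :=
  Matrix.of fun a b => arEntry c (fun _ => ρ) a b

theorem toeplitzMatrix_isHermitian (c ρ : ℝ) (n : ℕ) : (toeplitzMatrix c ρ n).IsHermitian := by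
  ext a b
  simp [toeplitzMatrix, arEntry_comm c _ (b : ℕ)]

/-- The sine vectors vanish at the virtual sites 0 and n + 1, so the recursion sin((a+2)θ) + sin(aθ)
= 2 cos θ sin((a+1)θ) needs no boundary correction. -/
theorem toeplitzMatrix_mulVec (c ρ : ℝ) (n : ℕ) (k : Fin n) :
    (toeplitzMatrix c ρ n).mulVec
      (fun a : Fin n => Real.sin ((a + 1 : ℕ) * (Real.pi * ((k + 1 : ℕ) / (n + 1 : ℕ))))) =
    arSymbol c ρ ((k + 1 : ℕ) / (n + 1 : ℕ)) •
      fun a : Fin n => Real.sin ((a + 1 : ℕ) * (Real.pi * ((k + 1 : ℕ) / (n + 1 : ℕ)))) := by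
  set θ := Real.pi * (((k + 1 : ℕ) : ℝ) / (n + 1 : ℕ)) with hθ
  funext a
  have ha := a.2
  simp only [Matrix.mulVec, dotProduct, toeplitzMatrix, Matrix.of_apply, Pi.smul_apply,
    smul_eq_mul, arSymbol, ← hθ]
  rw [Fin.sum_univ_eq_sum_range
    (fun b => arEntry c (fun _ => ρ) a b * Real.sin ((b + 1 : ℕ) * θ)) n]
  simp only [arEntry, mul_sub, sub_mul, mul_ite, mul_zero, ite_mul, zero_mul,
    Finset.sum_sub_distrib, Finset.sum_ite_eq, Finset.sum_ite_eq', Finset.mem_range, ha, if_true]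
  have h1 : (if (a : ℕ) + 1 < n then c * ρ * Real.sin (((a : ℕ) + 1 + 1 : ℕ) * θ) else 0) =
      c * ρ * Real.sin (((a : ℕ) + 2) * θ) := by
    split_ifs with h
    · push_cast; ring_nf
    · have han : ((a : ℕ) : ℝ) + 2 = (n + 1 : ℕ) := by
        have : (a : ℕ) + 2 = n + 1 := by omega
        exact_mod_cast this
      rw [han, hθ, mul_left_comm, mul_div_cancel₀ _ (by positivity),
        mul_comm Real.pi, Real.sin_nat_mul_pi, mul_zero]
  have h2 : (∑ b ∈ Finset.range n, if (a : ℕ) = b + 1 then c * ρ * Real.sin ((b + 1 : ℕ) * θ)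
      else 0) = c * ρ * Real.sin ((a : ℕ) * θ) := by
    rcases h : (a : ℕ) with _ | a'
    · simp
    · simp only [add_left_inj]
      rw [Finset.sum_ite_eq, if_pos (Finset.mem_range.2 (by omega))]
  rw [h1, h2]
  have h3 : Real.sin (((a : ℕ) + 2) * θ) =
      2 * Real.cos θ * Real.sin ((a + 1 : ℕ) * θ) - Real.sin ((a : ℕ) * θ) := by
    have e1 : ((a : ℕ) + 2 : ℝ) * θ = (a + 1 : ℕ) * θ + θ := by push_cast; ring
    have e2 : ((a : ℕ) : ℝ) * θ = (a + 1 : ℕ) * θ - θ := by push_cast; ring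
    rw [e1, e2, Real.sin_add, Real.sin_sub]; ring
  rw [h3]
  ring

/-- The cosine is injective on [0, π], so for c, ρ ≠ 0 the symbol takes n distinct values at the
nodes. Each is an eigenvalue, hence they exhaust the spectrum. -/
theorem sum_eigenvalues_toeplitzMatrix {c ρ : ℝ} (hc : c ≠ 0) (hρ : ρ ≠ 0) (n : ℕ) (f : ℝ → ℝ) :
    ∑ i, f ((toeplitzMatrix_isHermitian c ρ n).eigenvalues i) =
      ∑ k ∈ Finset.range n, f (arSymbol c ρ ((k + 1 : ℕ) / (n + 1 : ℕ))) := by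
  obtain ⟨Φ, -, hΦ⟩ := exists_spectral_coordinates (toeplitzMatrix_isHermitian c ρ n)
  have hmem : ∀ k : Fin n, (((k + 1 : ℕ) : ℝ) / (n + 1 : ℕ)) ∈ Set.Ioo (0 : ℝ) 1 := fun k => by
    refine ⟨by positivity, (div_lt_one (by positivity)).2 ?_⟩
    exact_mod_cast Nat.succ_lt_succ k.2
  have hex : ∀ k : Fin n, ∃ i, (toeplitzMatrix_isHermitian c ρ n).eigenvalues i =
      arSymbol c ρ ((k + 1 : ℕ) / (n + 1 : ℕ)) := fun k => by
    set v : Fin n → ℝ :=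
      fun a => Real.sin ((a + 1 : ℕ) * (Real.pi * ((k + 1 : ℕ) / (n + 1 : ℕ)))) with hv
    have hv0 : v ≠ 0 := fun h => by
      have h0 := congrFun h ⟨0, by have := k.2; omega⟩
      simp only [hv, zero_add, Nat.cast_one, one_mul, Pi.zero_apply] at h0
      refine (Real.sin_pos_of_pos_of_lt_pi ?_ ?_).ne' h0
      · exact mul_pos Real.pi_pos (hmem k).1
      · exact mul_lt_of_lt_one_right Real.pi_pos (hmem k).2
    -- Any nonzero eigencoordinate of v belongs to the eigenvalue of v.
    obtain ⟨i, hi⟩ := Function.ne_iff.1 ((LinearEquiv.map_ne_zero_iff Φ).2 hv0)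
    refine ⟨i, ?_⟩
    have h := hΦ v i
    rw [hv, toeplitzMatrix_mulVec, ← hv, map_smul, Pi.smul_apply, smul_eq_mul] at h
    exact (mul_right_cancel₀ hi h).symm
  choose σ hσ using hex
  have hinj : Function.Injective σ := fun k l hkl => by
    have h := (hσ k).symm.trans ((congrArg _ hkl).trans (hσ l))
    simp only [arSymbol] at h
    have hcos := mul_left_cancel₀ (mul_ne_zero two_ne_zero hρ)
      (sub_right_injective (mul_left_cancel₀ hc h))
    have hI : ∀ k : Fin n, Real.pi * (((k + 1 : ℕ) : ℝ) / (n + 1 : ℕ)) ∈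
        Set.Icc 0 Real.pi := fun k =>
      ⟨mul_nonneg Real.pi_pos.le (hmem k).1.le, mul_le_of_le_one_right Real.pi_pos.le (hmem k).2.le⟩
    have h1 := mul_left_cancel₀ Real.pi_pos.ne' (Real.injOn_cos (hI k) (hI l) hcos)
    rw [div_left_inj' (by positivity)] at h1
    have h2 : (k : ℕ) + 1 = l + 1 := by exact_mod_cast h1
    exact Fin.ext (by omega)
  rw [← Fin.sum_univ_eq_sum_range
    (fun k => f (arSymbol c ρ ((k + 1 : ℕ) / (n + 1 : ℕ)))) n,
    ← (Finite.injective_iff_bijective.1 hinj).sum_comp]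
  exact Finset.sum_congr rfl fun k _ => by rw [hσ]

theorem sum_abs_arEntry_le {c S : ℝ} (hc : 0 ≤ c) {s : ℕ → ℝ} (hs : ∀ t, |s t| ≤ S) (n a : ℕ) :
    ∑ b : Fin n, |arEntry c s a b| ≤ 3 * (c * (1 + S) ^ 2) := by
  refine sum_abs_band_le _ (fun b : Fin n => (b : ℤ)) a
    (fun i j _ _ h => Fin.ext (by exact_mod_cast h))
    (fun b => abs_arEntry_le hc hs a b) (fun b hb => ?_) (by positivity)
  exact arEntry_eq_zero c s (by rwa [abs_sub_comm])

/-- Row a deviates by a multiple of |s a - ρ| + |s (a+1) - ρ|, where 2S comes from the difference of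
squares. Each deviation is counted at most twice; the extra S pays for the coefficient cut to 0 at
index n. -/
theorem sum_abs_arMatrix_sub_le {c ρ S K : ℝ} (hc : 0 ≤ c) (hρ : |ρ| ≤ S) {s : ℕ → ℝ}
    (hs : ∀ t, |s t| ≤ S) {n : ℕ} (hK : ∑ t ∈ Finset.range n, |s t - ρ| ≤ K) :
    ∑ a, ∑ b, |(arMatrix c s n - toeplitzMatrix c ρ n) a b| ≤
      3 * (c * (2 * S + 1)) * (2 * (K + S)) := by
  have hS : 0 ≤ S := (abs_nonneg _).trans hρ
  set f := cutAt s n with hf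
  set g : ℕ → ℝ := fun t => |f t - ρ| with hg
  have hfS : ∀ t, |f t| ≤ S := abs_cutAt_le hs n
  have hg0 : ∀ t, 0 ≤ g t := fun t => abs_nonneg _
  have hrow : ∀ a : Fin n, ∑ b, |(arMatrix c s n - toeplitzMatrix c ρ n) a b| ≤
      3 * (c * (2 * S + 1) * (g a + g (a + 1))) := fun a => by
    have hpos : 0 ≤ c * (2 * S + 1) * (g a + g (a + 1)) :=
      mul_nonneg (by positivity) (add_nonneg (hg0 _) (hg0 _))
    refine sum_abs_band_le _ (fun b : Fin n => (b : ℤ)) a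
      (fun i j _ _ h => Fin.ext (by exact_mod_cast h)) (fun b => ?_) (fun b hb => ?_) hpos
    · have e : (arMatrix c s n - toeplitzMatrix c ρ n) a b =
          c * ((if (a : ℕ) = b then f (a + 1) ^ 2 - ρ ^ 2 else 0) -
            (if (b : ℕ) = a + 1 then f (a + 1) - ρ else 0) -
            (if (a : ℕ) = b + 1 then f a - ρ else 0)) := by
        simp only [Matrix.sub_apply, arMatrix, toeplitzMatrix, Matrix.of_apply, arEntry, ← hf]
        by_cases hb : (b : ℕ) = a + 1
        · rw [hb]; split_ifs <;> ring
        · split_ifs <;> ring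
      rw [e, abs_mul, abs_of_nonneg hc, mul_assoc]
      refine mul_le_mul_of_nonneg_left ?_ hc
      have h0 := hg0 a
      have h1 := hg0 (a + 1)
      have h2 : |f (a + 1) ^ 2 - ρ ^ 2| ≤ 2 * S * g (a + 1) := by
        rw [sq_sub_sq, abs_mul]
        refine mul_le_mul_of_nonneg_right ?_ h1
        exact (abs_add_le _ _).trans (by linarith [hfS (a + 1)])
      split_ifs <;> first | omega | skip
      · simp only [sub_zero]; nlinarith
      · simp only [zero_sub, sub_zero, abs_neg]
        change g (a + 1) ≤ _
        nlinarith
      · simp only [zero_sub, sub_zero, abs_neg]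
        change g a ≤ _
        nlinarith
      · simp only [sub_zero, abs_zero]; positivity
    · have hb' : ¬ |(a : ℤ) - b| ≤ 1 := by rwa [abs_sub_comm]
      simp only [Matrix.sub_apply, arMatrix, toeplitzMatrix, Matrix.of_apply]
      rw [arEntry_eq_zero c _ hb', arEntry_eq_zero c _ hb', sub_zero]
  have hG : ∑ t ∈ Finset.range (n + 1), g t ≤ K + S := by
    rw [Finset.sum_range_succ]
    refine add_le_add (le_trans (le_of_eq ?_) hK) ?_
    · refine Finset.sum_congr rfl fun t ht => ?_
      simp only [hg, hf, cutAt, if_pos (Finset.mem_range.1 ht)]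
    · simpa [hg, hf, cutAt] using hρ
  have h1 : ∑ t ∈ Finset.range n, g t ≤ K + S := by
    rw [Finset.sum_range_succ] at hG
    linarith [hg0 n]
  have h2 : ∑ t ∈ Finset.range n, g (t + 1) ≤ K + S := by
    rw [Finset.sum_range_succ'] at hG
    linarith [hg0 0]
  refine (Finset.sum_le_sum fun a _ => hrow a).trans ?_
  rw [Fin.sum_univ_eq_sum_range (fun a => 3 * (c * (2 * S + 1) * (g a + g (a + 1)))) n,
    ← Finset.mul_sum, ← Finset.mul_sum, Finset.sum_add_distrib, ← mul_assoc]
  exact mul_le_mul_of_nonneg_left (by linarith) (by positivity)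

theorem integral_esd {n : ℕ} (A : {A : Matrix (Fin n) (Fin n) ℝ // A.IsHermitian}) {f : ℝ → ℝ}
    (hf : StronglyMeasurable f) :
    ∫ x, f x ∂(esd A : Measure ℝ) = (n : ℝ)⁻¹ * ∑ i, f (A.2.eigenvalues i) := by
  have h : (esd A : Measure ℝ) =
      (n : ℝ≥0)⁻¹ • ∑ i, Measure.dirac (A.2.eigenvalues i) := by
    rw [esd, FiniteMeasure.toMeasure_smul, FiniteMeasure.toMeasure_sum]
    rfl
  rw [h, integral_smul_nnreal_measure, integral_finsetSum_measure]
  · simp_rw [integral_dirac' _ _ hf]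
    rw [NNReal.smul_def]
    simp
  · intro i _
    exact (integrable_dirac' hf (by simp))

/-- A model whose coefficients deviate only by a bounded total amount from `ρ` has the asymptotic
spectral distribution of the stationary autoregression. -/
theorem isASD_arLaw {c ρ S K : ℝ} (hc : 0 < c) (hρ0 : ρ ≠ 0) (hρ : |ρ| ≤ S) {A : SymmSeq}
    {s : ℕ → ℕ → ℝ} (hA : ∀ n, (A n).1 = arMatrix c (s n) n) (hs : ∀ n t, |s n t| ≤ S)
    (hK : ∀ n, ∑ t ∈ Finset.range n, |s n t - ρ| ≤ K) : IsASD A (arLaw c ρ) := by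
  have hS : 0 ≤ S := (abs_nonneg _).trans hρ
  refine ⟨?_, ?_⟩
  · rw [support_arLaw hc.le, isClosed_Icc.closure_eq]
    exact isCompact_Icc
  rw [FiniteMeasure.tendsto_iff_forall_integral_tendsto]
  intro f
  have hlim : ∫ x, f x ∂((arLaw c ρ).toFiniteMeasure : Measure ℝ) =
      ∫ u in (0 : ℝ)..1, f (arSymbol c ρ u) := by
    change ∫ x, f x ∂(arLaw c ρ : Measure ℝ) = _
    rw [coe_arLaw, integral_map (continuous_arSymbol c ρ).measurable.aemeasurable
      f.continuous.aestronglyMeasurable, integral_Icc_eq_integral_Ioc,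
      intervalIntegral.integral_of_le zero_le_one]
  rw [hlim]
  have hR := tendsto_interior_riemann_sum (f.continuous.comp (continuous_arSymbol c ρ))
  simp only [Function.comp_apply] at hR
  simp_rw [← sum_eigenvalues_toeplitzMatrix hc.ne' hρ0 _ f] at hR
  set M := 3 * (c * (1 + S) ^ 2) with hM
  have hM0 : 0 ≤ M := by positivity
  have hAM : ∀ n a, ∑ b, |(A n).1 a b| ≤ M := fun n a => by
    rw [hA]; exact sum_abs_arEntry_le hc.le (abs_cutAt_le (hs n) n) n a
  have hTM : ∀ n a, ∑ b, |toeplitzMatrix c ρ n a b| ≤ M := fun n a =>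
    sum_abs_arEntry_le hc.le (fun _ => hρ) n a
  suffices hdiff : Tendsto (fun n : ℕ => (n : ℝ)⁻¹ * (∑ i, f ((A n).2.eigenvalues i) -
      ∑ i, f ((toeplitzMatrix_isHermitian c ρ n).eigenvalues i))) atTop (𝓝 0) by
    have h := hdiff.add hR
    rw [zero_add] at h
    refine h.congr fun n => ?_
    rw [integral_esd (A n) f.continuous.stronglyMeasurable]
    ring
  rw [Metric.tendsto_atTop]
  intro ε hε
  -- Weierstrass on [-M, M], which contains both spectra. Replacing f by q costs nε/4 for each
  -- matrix, and the bounded difference of the polynomial sums is at most nε/4 for large n.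
  obtain ⟨q, hq⟩ := exists_polynomial_near_of_continuousOn (-M) M f f.continuous.continuousOn
    (ε / 4) (by positivity)
  obtain ⟨C, hC⟩ := exists_abs_sum_eval_sub_le q
    (V := 3 * (c * (2 * S + 1)) * (2 * (K + S))) hM0
  obtain ⟨N, hN⟩ := exists_nat_gt (4 * C / ε)
  refine ⟨N + 1, fun n hn => ?_⟩
  have hn0 : (0 : ℝ) < n := by exact_mod_cast (by omega : 0 < n)
  have hnN : (N : ℝ) ≤ n := by exact_mod_cast (by omega : N ≤ n)
  have hCn : C ≤ ε / 4 * n := by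
    rw [div_lt_iff₀ hε] at hN
    nlinarith
  have hnear : ∀ (B : Matrix (Fin n) (Fin n) ℝ) (hB : B.IsHermitian),
      (∀ a, ∑ b, |B a b| ≤ M) → |∑ i, f (hB.eigenvalues i) - ∑ i, q.eval (hB.eigenvalues i)| ≤
        n * (ε / 4) := fun B hB hBM => by
    rw [← Finset.sum_sub_distrib]
    refine (Finset.abs_sum_le_sum_abs _ _).trans ?_
    refine (Finset.sum_le_card_nsmul _ _ (ε / 4) fun i _ => ?_).trans ?_
    · rw [abs_sub_comm]
      exact (hq _ (abs_le.1 (abs_eigenvalues_le hB hM0 hBM i))).le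
    · simp
  have h1 := hnear _ (A n).2 (hAM n)
  have h2 := hnear _ (toeplitzMatrix_isHermitian c ρ n) (hTM n)
  have h3 := hC n _ _ (A n).2 (toeplitzMatrix_isHermitian c ρ n) (hAM n) (hTM n) (by
    rw [hA]; exact sum_abs_arMatrix_sub_le hc.le hρ (hs n) (hK n))
  rw [dist_zero_right, norm_mul, Real.norm_eq_abs, Real.norm_eq_abs, abs_of_pos (by positivity),
    ← div_eq_inv_mul, div_lt_iff₀ hn0]
  rw [abs_le] at h1 h2 h3
  have hεn : 0 < ε * n := by positivity
  rw [abs_lt]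
  constructor <;> linarith

/-! ## Persistent eigenvalue counts -/

/-- Every neighbourhood contains at least `r` points for all large `n`. -/
def PersistentCount (f : ℕ → ℝ → ℕ) (r : ℕ) : Prop := ∀ δ > 0, ∀ᶠ n in atTop, r ≤ f n δ

theorem PersistentCount.mono {f : ℕ → ℝ → ℕ} {r r' : ℕ} (h : PersistentCount f r) (hr : r' ≤ r) :
    PersistentCount f r' := fun δ hδ => (h δ hδ).mono fun _ hn => hr.trans hn

/-- The persistent numbers are closed downwards and bounded by C, so they have a largest element:
the multiplicity, in the form used below. -/
theorem exists_persistentCount_iff {f : ℕ → ℝ → ℕ} {C : ℕ} {δ : ℝ} (hδ : 0 < δ)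
    (hC : ∀ᶠ n in atTop, f n δ ≤ C) : ∃ ℓ, ∀ r, PersistentCount f r ↔ r ≤ ℓ := by
  classical
  have hb : ∀ r, PersistentCount f r → r ≤ C := fun r hr => by
    obtain ⟨n, h1, h2⟩ := ((hr δ hδ).and hC).exists
    exact h1.trans h2
  refine ⟨Nat.findGreatest (PersistentCount f) C, fun r =>
    ⟨fun hr => Nat.le_findGreatest (hb r hr) hr, fun hr => ?_⟩⟩
  exact (Nat.findGreatest_spec (P := PersistentCount f) (Nat.zero_le C)
    fun _ _ => Filter.Eventually.of_forall fun _ => Nat.zero_le _).mono hr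

/-- Persistent counts add up if all summands but the last one settle down. -/
theorem persistentCount_iff_le_sum {m : ℕ} {b : ℕ → ℝ → ℕ} {a : Fin m → ℕ → ℝ → ℕ}
    (ha : ∀ j n δ δ', δ ≤ δ' → a j n δ ≤ a j n δ') (hb : ∀ n δ δ', δ ≤ δ' → b n δ ≤ b n δ')
    {δ₀ : ℝ} (hδ₀ : 0 < δ₀)
    (hle : ∀ δ, 0 < δ → δ < δ₀ → ∀ᶠ n in atTop, b n δ ≤ ∑ j, a j n (2 * δ))
    (hge : ∀ δ, 0 < δ → δ < δ₀ → ∀ᶠ n in atTop, ∑ j, a j n δ ≤ b n (2 * δ))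
    (hsettle : ∀ j : Fin m, (j : ℕ) + 1 < m → ∀ δ, 0 < δ → δ < δ₀ →
      ∀ᶠ n in atTop, ∀ᶠ n' in atTop, a j n δ ≤ a j n' (2 * δ))
    {ℓ : Fin m → ℕ} (hℓ : ∀ j r, PersistentCount (a j) r ↔ r ≤ ℓ j) (r : ℕ) :
    PersistentCount b r ↔ r ≤ ∑ j, ℓ j := by
  constructor
  · intro hr
    rcases m with _ | m
    · obtain ⟨n, h1, h2⟩ := ((hr (δ₀ / 2) (by positivity)).and
        (hle (δ₀ / 2) (by positivity) (by linarith))).exists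
      simp only [Finset.univ_eq_empty, Finset.sum_empty] at h2 ⊢
      omega
    -- Maximality of ℓ j bounds the count only for infinitely many n'. Settling transfers the bound
    -- from such an n' to every large n, in a smaller window.
    have hup : ∀ j : Fin m, ∃ δ > 0, ∀ᶠ n in atTop, a j.castSucc n δ ≤ ℓ j.castSucc := by
      intro j
      have hnot : ¬ PersistentCount (a j.castSucc) (ℓ j.castSucc + 1) := by
        rw [hℓ]; omega
      simp only [PersistentCount, not_forall, not_eventually, not_le] at hnot
      obtain ⟨δ, hδ, hfr⟩ := hnot
      have hδ1 : 0 < min (δ / 2) (δ₀ / 2) := by positivity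
      refine ⟨min (δ / 2) (δ₀ / 2), hδ1, ?_⟩
      filter_upwards [hsettle j.castSucc (by simp) _ hδ1
        ((min_le_right _ _).trans_lt (by linarith))] with n hn
      obtain ⟨n', h1, h2⟩ := (hfr.and_eventually hn).exists
      have h3 := ha j.castSucc n' (2 * min (δ / 2) (δ₀ / 2)) δ
        (by linarith [min_le_left (δ / 2) (δ₀ / 2)])
      omega
    choose D hD hDle using hup
    rw [Fin.sum_univ_castSucc]
    -- All other summands are eventually at most their ℓ j, so what remains of r must persist in the
    -- last one.
    suffices h : PersistentCount (a (Fin.last m)) (r - ∑ j : Fin m, ℓ j.castSucc) by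
      rw [hℓ] at h; omega
    intro δ hδ
    obtain ⟨δ', hδ'0, hδ'δ, hδ'δ₀, hδ'D⟩ : ∃ δ' > 0, 2 * δ' ≤ δ ∧ δ' < δ₀ ∧
        ∀ j, 2 * δ' ≤ D j := by
      have hev : ∀ᶠ u : ℝ in 𝓝[>] 0, 2 * u ≤ δ ∧ u < δ₀ ∧ ∀ j, 2 * u ≤ D j := by
        have ht : Tendsto (fun u : ℝ => 2 * u) (𝓝[>] 0) (𝓝 0) := by
          have : Tendsto (fun u : ℝ => 2 * u) (𝓝 0) (𝓝 (2 * 0)) :=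
            (continuous_const.mul continuous_id).tendsto _
          rw [mul_zero] at this
          exact this.mono_left nhdsWithin_le_nhds
        refine (ht.eventually (eventually_le_nhds hδ)).and
          (((tendsto_id.mono_right nhdsWithin_le_nhds).eventually (eventually_lt_nhds hδ₀)).and
            (eventually_all.2 fun j => ht.eventually (eventually_le_nhds (hD j))))
      obtain ⟨u, hu, hu0⟩ := (hev.and self_mem_nhdsWithin).exists
      exact ⟨u, hu0, hu⟩
    filter_upwards [hr δ' hδ'0, hle δ' hδ'0 hδ'δ₀, eventually_all.2 hDle] with n h1 h2 h3
    rw [Fin.sum_univ_castSucc] at h2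
    have h4 : ∑ j : Fin m, a j.castSucc n (2 * δ') ≤ ∑ j : Fin m, ℓ j.castSucc :=
      Finset.sum_le_sum fun j _ => (ha _ _ _ _ (hδ'D j)).trans (h3 j)
    have h5 := ha (Fin.last m) n _ _ hδ'δ
    omega
  · intro hr δ hδ
    have hδ1 : 0 < min (δ / 2) (δ₀ / 2) := by positivity
    have hall : ∀ᶠ n in atTop, ∀ j, ℓ j ≤ a j n (min (δ / 2) (δ₀ / 2)) :=
      eventually_all.2 fun j => (hℓ j _).2 le_rfl _ hδ1
    filter_upwards [hall, hge _ hδ1 ((min_le_right _ _).trans_lt (by linarith))] with n h1 h2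
    refine hr.trans ((Finset.sum_le_sum fun j _ => h1 j).trans (h2.trans (hb _ _ _ ?_)))
    linarith [min_le_left (δ / 2) (δ₀ / 2)]

/-! ## Outliers as persistent eigenvalue counts -/

theorem IsASD.unique {A : SymmSeq} {μ ν : ProbabilityMeasure ℝ} (hμ : IsASD A μ)
    (hν : IsASD A ν) : μ = ν :=
  (ProbabilityMeasure.toFiniteMeasure_isEmbedding ℝ).injective
    (tendsto_nhds_unique hμ.tendsto_esd hν.tendsto_esd)

theorem one_le_eigenvalueCount_iff {n : ℕ}
    (A : {A : Matrix (Fin n) (Fin n) ℝ // A.IsHermitian}) (x δ : ℝ) :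
    1 ≤ eigenvalueCount A x δ ↔ ∃ y ∈ spectrum ℝ A.1, dist x y < δ := by
  rw [eigenvalueCount, Nat.one_le_iff_ne_zero, ← Nat.pos_iff_ne_zero, Finset.card_pos,
    A.2.spectrum_real_eq_range_eigenvalues, Set.exists_range_iff]
  simp [Finset.Nonempty, Real.dist_eq]

theorem tendsto_infDist_spectrum_iff (A : SymmSeq) (x : ℝ) :
    Tendsto (fun n => Metric.infDist x (spectrum ℝ (A n).1)) atTop (𝓝 0) ↔
      PersistentCount (fun n δ => eigenvalueCount (A n) x δ) 1 := by
  have hd : ∀ n, dist (Metric.infDist x (spectrum ℝ (A n).1)) 0 =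
      Metric.infDist x (spectrum ℝ (A n).1) := fun n => by
    rw [dist_zero_right, Real.norm_of_nonneg Metric.infDist_nonneg]
  simp only [Metric.tendsto_nhds, hd]
  refine forall₂_congr fun δ _ => eventually_congr ?_
  -- For n = 0 the spectrum is empty and `infDist` takes the default value 0.
  filter_upwards [eventually_gt_atTop 0] with n hn
  have hne : (spectrum ℝ (A n).1).Nonempty :=
    ⟨_, (A n).2.eigenvalues_mem_spectrum_real ⟨0, hn⟩⟩
  rw [Metric.infDist_lt_iff hne, one_le_eigenvalueCount_iff]

/-- Weak limits are unique, so the existential measure in the definition may be replaced by any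
known one. -/
theorem mem_outlierSet_iff {A : SymmSeq} {μ : ProbabilityMeasure ℝ} (hA : IsASD A μ) (x : ℝ) :
    x ∈ outlierSet A ↔ x ∉ closure (μ : Measure ℝ).support ∧
      PersistentCount (fun n δ => eigenvalueCount (A n) x δ) 1 := by
  rw [← tendsto_infDist_spectrum_iff]
  constructor
  · rintro ⟨ν, hν, h1, h2⟩
    rw [hA.unique hν]
    exact ⟨h2, h1⟩
  · rintro ⟨h1, h2⟩
    exact ⟨μ, hA, h2, h1⟩

theorem outlierMult_of_mem {A : SymmSeq} {μ : ProbabilityMeasure ℝ} (hA : IsASD A μ) {x : ℝ}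
    (hx : x ∈ closure (μ : Measure ℝ).support) : outlierMult A x = 0 :=
  if_neg fun h => ((mem_outlierSet_iff hA x).1 h).1 hx

theorem outlierMult_eq {A : SymmSeq} {μ : ProbabilityMeasure ℝ} (hA : IsASD A μ) {x : ℝ}
    (hx : x ∉ closure (μ : Measure ℝ).support) {ℓ : ℕ}
    (hℓ : ∀ r, PersistentCount (fun n δ => eigenvalueCount (A n) x δ) r ↔ r ≤ ℓ) :
    outlierMult A x = ℓ := by
  by_cases h : x ∈ outlierSet A
  · rw [outlierMult, if_pos h]
    refine le_antisymm (iSup₂_le fun r hr => ?_) ?_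
    · exact_mod_cast (hℓ r).1 hr
    · exact le_iSup₂_of_le ℓ ((hℓ ℓ).2 le_rfl) le_rfl
  · rw [outlierMult, if_neg h]
    have h1 : ¬ 1 ≤ ℓ := fun h1 => h ((mem_outlierSet_iff hA x).2 ⟨hx, (hℓ 1).2 h1⟩)
    have : ℓ = 0 := by omega
    rw [this, Nat.cast_zero]

/-! ## The structural change model -/

section model

variable {ρ : ℝ} {m : ℕ}

theorem abs_scmCoeff_sub_le (ρ : ℝ) (ε : Fin m → ℝ) (k h : Fin m → ℕ) (t : ℕ) :
    |scmCoeff ρ ε k h t - ρ| ≤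
      ∑ j, (Set.Ico (k j) (k j + h j)).indicator (fun _ => |ε j|) t := by
  rw [scmCoeff, add_sub_cancel_left]
  refine (Finset.abs_sum_le_sum_abs _ _).trans (Finset.sum_le_sum fun j _ => ?_)
  by_cases ht : t ∈ Set.Ico (k j) (k j + h j)
  · rw [Set.indicator_of_mem ht, Set.indicator_of_mem ht]
  · rw [Set.indicator_of_notMem ht, Set.indicator_of_notMem ht, abs_zero]

theorem abs_scmCoeff_le (ρ : ℝ) (ε : Fin m → ℝ) (k h : Fin m → ℕ) (t : ℕ) :
    |scmCoeff ρ ε k h t| ≤ |ρ| + ∑ j, |ε j| := by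
  have h1 : |scmCoeff ρ ε k h t - ρ| ≤ ∑ j, |ε j| :=
    (abs_scmCoeff_sub_le ρ ε k h t).trans (Finset.sum_le_sum fun j _ =>
      Set.indicator_le_self' (fun _ _ => abs_nonneg _) t)
  have h2 := abs_sub_abs_le_abs_sub (scmCoeff ρ ε k h t) ρ
  linarith

/-- The bound is independent of n and of the positions of the breaks, so the perturbation is
negligible in the spectral distribution. -/
theorem sum_abs_scmCoeff_sub_le (ρ : ℝ) (ε : Fin m → ℝ) (k h : Fin m → ℕ) (n : ℕ) :
    ∑ t ∈ Finset.range n, |scmCoeff ρ ε k h (t + 1) - ρ| ≤ ∑ j, h j * |ε j| := by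
  refine (Finset.sum_le_sum fun t _ => abs_scmCoeff_sub_le ρ ε k h (t + 1)).trans ?_
  rw [Finset.sum_comm]
  refine Finset.sum_le_sum fun j _ => ?_
  simp only [Set.indicator_apply, Set.mem_Ico]
  rw [← Finset.sum_filter, Finset.sum_const, nsmul_eq_mul]
  refine mul_le_mul_of_nonneg_right ?_ (abs_nonneg _)
  have : (Finset.filter (fun t => k j ≤ t + 1 ∧ t + 1 < k j + h j) (Finset.range n)).card ≤
      (Finset.Ico (k j) (k j + h j)).card := by
    refine Finset.card_le_card_of_injOn (fun t => t + 1) (fun t ht => ?_) fun a _ b _ hab => ?_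
    · simpa using (Finset.mem_filter.1 ht).2
    · simpa using hab
  rw [Nat.card_Ico, Nat.add_sub_cancel_left] at this
  exact_mod_cast this

/-- The margin `h j + 2` serves both sides of the break: the length of the change on the right and
the index shift t + 1 on the left. -/
theorem scmCoeff_eq_of_far {ε : Fin m → ℝ} {k h : Fin m → ℕ} {R t : ℕ}
    (hR : ∀ j, h j + 2 ≤ R) (ht : ∀ j, (R : ℤ) ≤ |(t : ℤ) - k j|) :
    scmCoeff ρ ε k h (t + 1) = ρ := by
  rw [scmCoeff, Finset.sum_eq_zero fun j _ => ?_, add_zero]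
  refine Set.indicator_of_notMem (fun hmem => ?_) _
  rw [Set.mem_Ico] at hmem
  have h1 := ht j
  have h2 := hR j
  rw [le_abs] at h1
  omega

/-- The coefficients of the submodel that keeps only the `j`-th change. -/
theorem scmCoeff_eq_submodel {ε : Fin m → ℝ} {k h : Fin m → ℕ} {R t : ℕ} (j : Fin m)
    (hR : ∀ j, h j + 2 ≤ R) (ht : ∀ i, i ≠ j → (R : ℤ) ≤ |(t : ℤ) - k i|) :
    scmCoeff ρ ε k h (t + 1) =
      scmCoeff ρ (fun _ : Fin 1 => ε j) (fun _ => k j) (fun _ => h j) (t + 1) := by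
  rw [scmCoeff, scmCoeff, Fin.sum_univ_one, Finset.sum_eq_single j]
  · intro i _ hij
    refine Set.indicator_of_notMem (fun hmem => ?_) _
    rw [Set.mem_Ico] at hmem
    have h1 := ht i hij
    have h2 := hR i
    rw [le_abs] at h1
    omega
  · simp

theorem coe_scmPrecision {Ω : Type*} [MeasurableSpace Ω] {P : Measure Ω} [IsProbabilityMeasure P]
    {z : ℕ → Ω → ℝ} {σ2 : ℝ} (hσ2 : 0 < σ2) (hz : IsWhiteNoise P z σ2) (ε : Fin m → ℝ)
    (k : ℕ → Fin m → ℕ) (h : Fin m → ℕ) (n : ℕ) :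
    (scmPrecision P z ρ ε k h n).1 =
      arMatrix σ2⁻¹ (fun t => scmCoeff ρ ε (k n) h (t + 1)) n :=
  inv_covMatrix_arProcess hσ2 hz _ n

theorem isASD_scmPrecision {Ω : Type*} [MeasurableSpace Ω] {P : Measure Ω}
    [IsProbabilityMeasure P] {z : ℕ → Ω → ℝ} {σ2 : ℝ} (hσ2 : 0 < σ2) (hz : IsWhiteNoise P z σ2)
    (hρ0 : ρ ≠ 0) (ε : Fin m → ℝ) (k : ℕ → Fin m → ℕ) (h : Fin m → ℕ) :
    IsASD (scmPrecision P z ρ ε k h) (arLaw σ2⁻¹ ρ) :=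
  isASD_arLaw (inv_pos.2 hσ2) hρ0
    (le_add_of_nonneg_right (Finset.sum_nonneg fun j _ => abs_nonneg (ε j)))
    (coe_scmPrecision hσ2 hz ε k h) (fun n t => abs_scmCoeff_le ρ ε (k n) h (t + 1))
    (fun n => sum_abs_scmCoeff_sub_le ρ ε (k n) h n)

/-- A spacing is measured from the last index of the previous change, which is not before its first
since h ≥ 1; so break points are at least as far apart as the spacings. -/
theorem add_le_of_le_spacing {k h : Fin m → ℕ} (hh : ∀ j, 1 ≤ h j) {L : ℕ}
    (hL : ∀ j, (L : ℤ) ≤ spacing k h j) (i : ℕ) :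
    ∀ (j : ℕ) (hj : j < m) (hij : i < j), k ⟨i, hij.trans hj⟩ + L ≤ k ⟨j, hj⟩ := by
  intro j
  induction j with
  | zero => intro _ hij; omega
  | succ j ih =>
    intro hj hij
    have h1 := hL ⟨j + 1, hj⟩
    simp only [spacing, Nat.add_sub_cancel, Nat.succ_ne_zero, if_false] at h1
    have h2 := hh ⟨j, by omega⟩
    rcases Nat.lt_succ_iff_lt_or_eq.1 hij with h3 | rfl
    · have := ih (by omega) h3
      omega
    · omega

theorem le_of_le_spacing {k h : Fin m → ℕ} (hh : ∀ j, 1 ≤ h j) {L : ℕ}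
    (hL : ∀ j, (L : ℤ) ≤ spacing k h j) (j : Fin m) : L ≤ k j := by
  obtain ⟨j, hj⟩ := j
  rcases Nat.eq_zero_or_pos j with rfl | h0
  · have h1 := hL ⟨0, hj⟩
    simp only [spacing, if_true] at h1
    omega
  · have := add_le_of_le_spacing hh hL 0 j hj h0
    omega

theorem le_abs_sub_of_le_spacing {k h : Fin m → ℕ} (hh : ∀ j, 1 ≤ h j) {L : ℕ}
    (hL : ∀ j, (L : ℤ) ≤ spacing k h j) {i j : Fin m} (hij : i ≠ j) :
    (L : ℤ) ≤ |(k i : ℤ) - k j| := by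
  rw [le_abs]
  rcases lt_or_gt_of_ne (fun h => hij (Fin.ext h) : (i : ℕ) ≠ j) with h1 | h1
  · have := add_le_of_le_spacing hh hL i j j.2 h1
    simp only [Fin.eta] at this
    omega
  · have := add_le_of_le_spacing hh hL j i i.2 h1
    simp only [Fin.eta] at this
    omega

/-- With breaks 4R + 4 apart, a point within 2R + 2 of one break is at least 2R + 2 away from every
other. -/
theorem localChanges_scmCoeff {ε : Fin m → ℝ} {k h : Fin m → ℕ} (hh : ∀ j, 1 ≤ h j) {R : ℕ}
    (hR1 : 1 ≤ R) (hR : ∀ j, h j + 2 ≤ R) (hL : ∀ j, ((4 * R + 4 : ℕ) : ℤ) ≤ spacing k h j) :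
    LocalChanges ρ (|ρ| + ∑ j, |ε j|) R k (fun t => scmCoeff ρ ε k h (t + 1))
      (fun j t => scmCoeff ρ (fun _ : Fin 1 => ε j) (fun _ => k j) (fun _ => h j) (t + 1)) where
  one_le := hR1
  bound t := abs_scmCoeff_le ρ ε k h (t + 1)
  bound_sub j t := by
    refine (abs_scmCoeff_le ρ _ _ _ (t + 1)).trans (add_le_add le_rfl ?_)
    rw [Fin.sum_univ_one]
    exact Finset.single_le_sum (f := fun j => |ε j|) (fun _ _ => abs_nonneg _)
      (Finset.mem_univ j)
  near j t ht := by
    refine scmCoeff_eq_submodel j hR fun i hij => ?_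
    have h1 := le_abs_sub_of_le_spacing hh hL hij
    rw [abs_le] at ht
    rw [le_abs] at h1 ⊢
    push_cast at h1
    omega
  far_sub j t ht := scmCoeff_eq_of_far (fun _ => hR j) fun _ => ht
  far t ht := scmCoeff_eq_of_far hR ht
  separated i j hij := by
    have h1 := le_abs_sub_of_le_spacing hh hL hij
    push_cast at h1
    omega

end model

theorem exists_cutoff_scale {m : ℕ} (h : Fin m → ℕ) {C δ : ℝ} (N : ℕ) (hδ : 0 < δ) :
    ∃ R : ℕ, 1 ≤ R ∧ (∀ j, h j + 2 ≤ R) ∧ 3 * ((N : ℝ) + 1) * (C / R) ≤ δ / 4 := by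
  obtain ⟨T, hT⟩ := exists_nat_ge (12 * ((N : ℝ) + 1) * C / δ)
  refine ⟨T + ∑ j, h j + 2, by omega, fun j => ?_, ?_⟩
  · have := Finset.single_le_sum (f := h) (fun _ _ => Nat.zero_le _) (Finset.mem_univ j)
    omega
  · rw [div_le_iff₀ hδ] at hT
    have hTR : (T : ℝ) ≤ (T + ∑ j, h j + 2 : ℕ) := by exact_mod_cast (by omega)
    have hR0 : (0 : ℝ) < (T + ∑ j, h j + 2 : ℕ) := by exact_mod_cast (by omega)
    rw [mul_div_assoc', div_le_iff₀ hR0]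
    have := mul_le_mul_of_nonneg_right hTR hδ.le
    linarith

/-- Outside the support of the asymptotic spectral distribution, the persistent eigenvalue counts
of the submodels are finite and add up to the one of the full model. -/
theorem exists_persistentCount_scmPrecision {Ω : Type*} [MeasurableSpace Ω] {P : Measure Ω}
    [IsProbabilityMeasure P] {z : ℕ → Ω → ℝ} {σ2 : ℝ} (hσ2 : 0 < σ2) (hz : IsWhiteNoise P z σ2)
    {ρ : ℝ} (hρ1 : |ρ| < 1) {m : ℕ} (ε : Fin m → ℝ) {h : Fin m → ℕ} (hh : ∀ j, 1 ≤ h j)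
    {k : ℕ → Fin m → ℕ} (hk : ∀ᶠ n in atTop, ∀ j, k n j + h j ≤ n + 1)
    (hΔ : ∀ j, Tendsto (fun n => spacing (k n) h j) atTop atTop) {x : ℝ}
    (hx : x ∉ Set.Icc (σ2⁻¹ * (1 - |ρ|) ^ 2) (σ2⁻¹ * (1 + |ρ|) ^ 2)) :
    ∃ ℓ : Fin m → ℕ,
      (∀ j r, PersistentCount (fun n δ => eigenvalueCount
        (submodelPrecision P z ρ ε k h j n) x δ) r ↔ r ≤ ℓ j) ∧
      ∀ r, PersistentCount (fun n δ => eigenvalueCount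
        (scmPrecision P z ρ ε k h n) x δ) r ↔ r ≤ ∑ j, ℓ j := by
  set c := σ2⁻¹ with hc
  have hc0 : 0 ≤ c := (inv_pos.2 hσ2).le
  set S := |ρ| + ∑ j, |ε j| with hS
  set s : ℕ → ℕ → ℝ := fun n t => scmCoeff ρ ε (k n) h (t + 1) with hs
  set sub : ℕ → Fin m → ℕ → ℝ := fun n j t =>
    scmCoeff ρ (fun _ : Fin 1 => ε j) (fun _ => k n j) (fun _ => h j) (t + 1) with hsub
  have hfull : ∀ n δ, eigenvalueCount (scmPrecision P z ρ ε k h n) x δ =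
      eigCount (arMatrix c (s n) n) x δ := fun n δ => by
    rw [eigenvalueCount_eq_eigCount, coe_scmPrecision hσ2 hz]
  have hpart : ∀ j n δ, eigenvalueCount (submodelPrecision P z ρ ε k h j n) x δ =
      eigCount (arMatrix c (sub n j) n) x δ := fun j n δ => by
    rw [eigenvalueCount_eq_eigCount, submodelPrecision, coe_scmPrecision hσ2 hz]
  simp only [hfull, hpart]
  obtain ⟨d, hd0, hd⟩ : ∃ d > 0, x + d ≤ c * (1 - |ρ|) ^ 2 ∨ c * (1 + |ρ|) ^ 2 + d ≤ x := by
    rw [Set.mem_Icc, not_and_or, not_le, not_le] at hx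
    rcases hx with hx | hx
    · exact ⟨c * (1 - |ρ|) ^ 2 - x, sub_pos.2 hx, Or.inl (by linarith)⟩
    · exact ⟨x - c * (1 + |ρ|) ^ 2, sub_pos.2 hx, Or.inr (by linarith)⟩
  have hbulk := le_nrm_arMatrix_const_sub hc0 hρ1.le hd
  have hsep : ∀ L : ℕ, ∀ᶠ n in atTop, ∀ j, (L : ℤ) ≤ spacing (k n) h j := fun L =>
    eventually_all.2 fun j => (hΔ j).eventually_ge_atTop _
  have hscale : ∀ δ > 0, ∃ R : ℕ, 1 ≤ R ∧ (∀ j, h j + 2 ≤ R) ∧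
      3 * (Fintype.card (Fin m) + 1) * (c * (1 + S) ^ 2 / R) ≤ δ / 4 := fun δ hδ => by
    exact exists_cutoff_scale h _ hδ
  -- With η = δ/4 the condition reads 5δ ≤ d, whence the threshold d/5.
  have hsmall : ∀ δ, 0 < δ → δ < d / 5 → 1 / d * (δ + δ / 4) ≤ 1 / 4 := fun δ _ hδ => by
    rw [one_div, ← div_eq_inv_mul, div_le_iff₀ hd0]; linarith
  -- A single change has a number of eigenvalues in the window d bounded in terms of h j alone, so
  -- multiplicities are finite.
  have hbdd : ∀ j, ∃ ℓ, ∀ r, PersistentCount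
      (fun n δ => eigCount (arMatrix c (sub n j) n) x δ) r ↔ r ≤ ℓ := fun j =>
    exists_persistentCount_iff hd0 (Eventually.of_forall fun n =>
      eigCount_le_of_far (R := h j + 2) (k := k n j)
        (fun t ht => scmCoeff_eq_of_far (fun _ => le_rfl) fun _ => ht) (hbulk n))
  choose ℓ hℓ using hbdd
  refine ⟨ℓ, hℓ, persistentCount_iff_le_sum
    (b := fun n δ => eigCount (arMatrix c (s n) n) x δ)
    (a := fun j n δ => eigCount (arMatrix c (sub n j) n) x δ)
    (fun _ _ _ _ hδ => eigCount_mono _ _ hδ) (fun _ _ _ hδ => eigCount_mono _ _ hδ) (δ₀ := d / 5) (by positivity) ?_ ?_ ?_ hℓ⟩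
  · intro δ hδ hδd
    obtain ⟨R, hR1, hR, hη⟩ := hscale δ hδ
    filter_upwards [hsep (4 * R + 4)] with n hn
    exact (localChanges_scmCoeff hh hR1 hR hn).eigCount_le hc0 hd0 hδ hη le_rfl
      (hsmall δ hδ hδd) (hbulk n)
  · intro δ hδ hδd
    obtain ⟨R, hR1, hR, hη⟩ := hscale δ hδ
    filter_upwards [hsep (4 * R + 4)] with n hn
    exact (localChanges_scmCoeff hh hR1 hR hn).sum_eigCount_le hc0 hd0 hδ hη le_rfl
      (hsmall δ hδ hδd) (hbulk n)
  · intro j hj δ hδ hδd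
    obtain ⟨R, hR1, hR, hη⟩ := hscale δ hδ
    -- The next break lies at least 4R + 4 after this one and still within the sample, which keeps
    -- this change away from the right end. The last change has no such protection.
    have hgood : ∀ᶠ n in atTop, 2 * R + 2 ≤ k n j ∧ k n j + 2 * R + 2 < n ∧
        ∀ t, |sub n j t| ≤ S := by
      filter_upwards [hsep (4 * R + 4), hk] with n hn hkn
      have h1 := le_of_le_spacing hh hn j
      have h2 := add_le_of_le_spacing hh hn j (j + 1) hj (Nat.lt_succ_self _)
      have h3 := hkn ⟨j + 1, hj⟩
      simp only [Fin.eta] at h2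
      exact ⟨by omega, by omega, (localChanges_scmCoeff hh hR1 hR hn).bound_sub j⟩
    filter_upwards [hgood] with n hn
    filter_upwards [hgood] with n' hn'
    refine eigCount_le_of_shift (R := R) (k := k n j) (k' := k n' j) hR1 hc0 hd0 hδ
      (le_trans ?_ hη) le_rfl (hsmall δ hδ hδd) hn.2.2 hn'.2.2
      (fun t ht => scmCoeff_eq_of_far (fun _ => hR j) fun _ => ht) (fun t t' htt => ?_)
      hn.1 hn.2.1 hn'.1 hn'.2.1 (hbulk n)
    · have h1 : 0 ≤ c * (1 + S) ^ 2 / R := by positivity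
      have h2 : 0 ≤ 3 * (Fintype.card (Fin m) : ℝ) * (c * (1 + S) ^ 2 / R) := by positivity
      linarith
    · simp only [hsub, scmCoeff, Fin.sum_univ_one, Set.indicator_apply, Set.mem_Ico]
      have hiff : (k n j ≤ t + 1 ∧ t + 1 < k n j + h j) ↔
          (k n' j ≤ t' + 1 ∧ t' + 1 < k n' j + h j) := by omega
      simp only [hiff]

end

end SCM

theorem theorem3p6 {Ω : Type*} [MeasurableSpace Ω] (P : Measure Ω) [IsProbabilityMeasure P]
    (z : ℕ → Ω → ℝ) (σ2 : ℝ) (hσ2 : 0 < σ2) (hz : SCM.IsWhiteNoise P z σ2)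
    (ρ : ℝ) (hρ0 : ρ ≠ 0) (hρ1 : |ρ| < 1)
    (m : ℕ) (ε : Fin m → ℝ) (h : Fin m → ℕ) (hh : ∀ j, 1 ≤ h j)
    (k : ℕ → Fin m → ℕ)
    (hk : ∀ᶠ n in atTop, ∀ j, k n j + h j ≤ n + 1)
    (hΔ : ∀ j, Tendsto (fun n => SCM.spacing (k n) h j) atTop atTop)
    (hε : ∀ j, |ρ| < |ρ + ε j|) :
    -- the general model and all its submodels share an asymptotic spectral distribution
    (∃ μ : ProbabilityMeasure ℝ, SCM.IsASD (SCM.scmPrecision P z ρ ε k h) μ ∧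
      ∀ j, SCM.IsASD (SCM.submodelPrecision P z ρ ε k h j) μ) ∧
    -- equality of the sets of outliers
    SCM.outlierSet (SCM.scmPrecision P z ρ ε k h) =
      ⋃ j, SCM.outlierSet (SCM.submodelPrecision P z ρ ε k h j) ∧
    -- equality of the multisets of outliers, whose multiplicities are finite
    ∀ x : ℝ,
      SCM.outlierMult (SCM.scmPrecision P z ρ ε k h) x ≠ ⊤ ∧
      SCM.outlierMult (SCM.scmPrecision P z ρ ε k h) x =
        ∑ j, SCM.outlierMult (SCM.submodelPrecision P z ρ ε k h j) x := by
  have hfull := SCM.isASD_scmPrecision hσ2 hz hρ0 ε k h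
  have hpart : ∀ j, SCM.IsASD (SCM.submodelPrecision P z ρ ε k h j) (SCM.arLaw σ2⁻¹ ρ) :=
    fun j => SCM.isASD_scmPrecision hσ2 hz hρ0 _ _ _
  have hsupp : closure (SCM.arLaw σ2⁻¹ ρ : Measure ℝ).support =
      Set.Icc (σ2⁻¹ * (1 - |ρ|) ^ 2) (σ2⁻¹ * (1 + |ρ|) ^ 2) := by
    rw [SCM.support_arLaw (inv_pos.2 hσ2).le, isClosed_Icc.closure_eq]
  refine ⟨⟨_, hfull, hpart⟩, ?_, fun x => ?_⟩
  · ext x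
    rw [Set.mem_iUnion, SCM.mem_outlierSet_iff hfull]
    simp only [SCM.mem_outlierSet_iff (hpart _)]
    rw [exists_and_left]
    refine and_congr_right fun hx => ?_
    rw [hsupp] at hx
    obtain ⟨ℓ, hℓ, hsum⟩ :=
      SCM.exists_persistentCount_scmPrecision hσ2 hz hρ1 ε hh hk hΔ hx
    rw [hsum]
    -- A sum of natural numbers is nonzero exactly if some summand is, so additivity of
    -- multiplicities contains the equality of sets.
    simp only [hℓ, Nat.one_le_iff_ne_zero, ne_eq, Finset.sum_eq_zero_iff, Finset.mem_univ,
      true_implies, not_forall]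
  · by_cases hx : x ∈ closure (SCM.arLaw σ2⁻¹ ρ : Measure ℝ).support
    · simp [SCM.outlierMult_of_mem hfull hx, SCM.outlierMult_of_mem (hpart _) hx]
    · obtain ⟨ℓ, hℓ, hsum⟩ := SCM.exists_persistentCount_scmPrecision hσ2 hz hρ1 ε hh hk hΔ
        (hsupp ▸ hx)
      rw [SCM.outlierMult_eq hfull hx hsum]
      refine ⟨ENat.natCast_ne_top _, ?_⟩
      rw [Nat.cast_sum]
      exact Finset.sum_congr rfl fun j _ => (SCM.outlierMult_eq (hpart j) hx (hℓ j)).symm
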